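/- Write $(a)_k=a(a+1)\cdots(a+k-1)$ and let $n\in\mathbb Z_{\ge0}$. Consider the following four families of polynomials $P_n(\eta;\lambda)$ with real parameters $\lambda$, sinusoidal coordinate $\eta=\eta(x)$, parameter shift $\delta$, polynomial $c_2(\eta)$ and constant $c_F$: - Laguerre: $\lambda=g$, $\eta(x)=x^2$, $\delta=1$, $c_2=\eta$, $c_F=2$, $P_n=L_n^{(g-1/2)}(\eta)=\frac{(g+1/2)_n}{n!}\,{}_1F_1(-n;g+\tfrac12\,|\,\eta)$; - Jacobi: $\lambda=(g,h)$, $\eta(x)=\cos 2x$, $\delta=(1,1)$, $c_2=1-\eta^2$, $c_F=-4$, $P_n=P_n^{(g-1/2,h-1/2)}(\eta)=\frac{(g+1/2)_n}{n!}\,{}_2F_1(-n,n+g+h;g+\tfrac12\,|\,\tfrac{1-\eta}2)$; - Bessel: $\lambda=h$, $\eta(x)=e^x$, $\delta=-1$, $4c_2=\eta^2$, $c_F=1$, $P_n=y_n(\eta;-2h-1)={}_2F_0(-n,n-2h;-\,|\,-\tfrac\eta2)$; - pseudo Jacobi: $\lambda=(h,\mu)$, $\eta(x)=\sinh x$, $\delta=(-1,0)$,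 $4c_2=1+\eta^2$, $c_F=1$, $P_n=\frac{(-2i)^n n!}{(n-2h)_n}P_n^{(-h-1/2-i\mu,\,-h-1/2+i\mu)}(i\eta)$, defined when $(n-2h)_n\ne0$. (In the first two formulas and in the last one, $(a)_n/(a)_k$ is read as $(a+k)_{n-k}$.) Put $\check P_n(x;\lambda)=P_n(\eta(x);\lambda)$, let $c_n(\lambda)$ be the coefficient of $\eta^n$ in $P_n(\eta;\lambda)$, and let $\Phi(\eta)=\frac{4}{c_F^2}c_2(\eta)$, $\check\Phi(x)=\Phi(\eta(x))$. Then $\Phi(\eta)=c^\Phi\prod_{j=1}^m(\eta-\eta_j)$, where - Laguerre: $m=1$, $c^\Phi=1$, $\eta_1=0$, $\check\Phi=x^2$; - Jacobi: $m=2$, $c^\Phi=-\frac14$, $\eta_{1,2}=\pm1$, $\check\Phi=(\sin x\cos x)^2$; - Bessel: $m=2$, $c^\Phi=1$, $\eta_1=\eta_2=0$, $\check\Phi=e^{2x}$; - pseudo Jacobi: $m=2$, $c^\Phi=1$, $\eta_{1,2}=\pm i$, $\check\Phi=\cosh^2x$. For $1\le j\le m$ let $p_{n,j}=P_n(\eta_j;\lambda)$,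 except that in the Bessel case $p_{n,2}=P_n'(0;\lambda)$ (double zero). For $0\le k\le m$ define $$\alpha_{n,k}(\lambda)=(-1)^{m-k}\frac{\det(p_{n+\ell,j})_{1\le j\le m,\ \ell\in\{0,\dots,m\}\setminus\{k\}}}{\det(p_{n+\ell,j})_{1\le j\le m,\ \ell\in\{0,\dots,m-1\}}},\qquad \beta_n(\lambda)=c^\Phi\frac{c_n(\lambda+\delta)}{c_{n+m}(\lambda)}.$$ **(A)** Assume - Laguerre: $(g+\frac12)_n\neq0$; - Jacobi: $(g+\frac12)_n(h+\frac12)_n\ne0$, $2n+g+h+1\ne0$, $(n+2+g+h)_{n+2}\ne0$; - Bessel: $2n-2h+1\ne0$, $(n+2-2h)_{n+2}\ne0$; - pseudo Jacobi: $(n+i-2h)_{n+i}\neq0$ for $i=0,1,2$ (all polynomials involved are defined), and not both $\mu=0$ and $h\in\{\frac12,\frac32,\dots,n-\frac12\}$. Then both denominators above are nonzero, and for all real $x$ $$\check\Phi(x)\,\check P_n(x;\lambda+\delta)=\beta_n(\lambda)\sum_{k=0}^m\alpha_{n,k}(\lambda)\,\check P_{n+k}(x;\lambda).$$ Moreover,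 with $D_n^{(\ell_1,\dots,\ell_m)}=\det(p_{n+\ell_k,j}/p_{n,j})_{1\le j,k\le m}$ one has $p_{n,j}\ne0$ for all $j$, $D_n^{(0,\dots,m-1)}\neq0$ and $\alpha_{n,k}=(-1)^{m-k}D_n^{(0,\dots,\breve k,\dots,m)}/D_n^{(0,\dots,m-1)}$, where $\breve k$ means that $k$ is omitted (in the Bessel case provided that $n\ne0$ and $n\neq 2h$). Further $\alpha_{n,m}=1$ and - Laguerre: $\alpha_{n,0}=-\frac{n+g+1/2}{n+1}$, $\beta_n=-(n+1)$; - Jacobi: $\alpha_{n,1}=-\frac{(g-h)(2n+g+h+2)}{(n+2)(2n+g+h+1)}$, $\alpha_{n,0}=-\frac{(n+g+1/2)(n+h+1/2)(2n+g+h+3)}{(n+1)(n+2)(2n+g+h+1)}$, $\beta_n=-\frac{(n+1)(n+2)}{(2n+g+h+2)(2n+g+h+3)}$; - Bessel: $\alpha_{n,1}=-\frac{4(n-h+1)}{2n-2h+1}$, $\alpha_{n,0}=\frac{2n-2h+3}{2n-2h+1}$, $\beta_n=\frac4{(2n-2h+2)(2n-2h+3)}$; - pseudo Jacobi: $\beta_n=1$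 and, if $h\neq n$, $\alpha_{n,1}=-\frac{4\mu(2h-n-1)}{(2h-2n-1)(2h-2n-3)}$, $\alpha_{n,0}=\frac{(2h-n-1)(2h-n)((2h-2n-1)^2+4\mu^2)}{4(h-n-1)(h-n)(2h-2n-1)^2}$. **(B)** With $\alpha_{n,k}$ and $\beta_n$ given by these closed forms, the displayed relation holds for all real $x$ whenever the closed forms and the polynomials are defined: for all $g$ (Laguerre); if $2n+g+h+1,\ 2n+g+h+2,\ 2n+g+h+3\ne0$ (Jacobi); if $2n-2h+1,\ 2n-2h+2,\ 2n-2h+3\neq0$ (Bessel); if $(n+i-2h)_{n+i}\ne0$ for $i=0,1,2$ and $h\ne n$ (pseudo Jacobi). -/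

import Mathlib

open Polynomial

noncomputable section

/-- The Pochhammer symbol `(a)_k = a (a + 1) ⋯ (a + k - 1)`. -/
def poch (a : ℂ) (k : ℕ) : ℂ := (ascPochhammer ℂ k).eval a

/-- The Laguerre polynomial `L_n^{(α)}(η) = (α+1)_n / n! * ₁F₁(-n; α+1 | η)`.
The quotient `(α+1)_n / (α+1)_k` is written as `(α+1+k)_{n-k}`, so that the polynomial is defined
for every `α`. -/
def laguerrePoly (α : ℂ) (n : ℕ) : ℂ[X] :=
  ∑ k ∈ Finset.range (n + 1),
    C (poch (-n) k * poch (α + 1 + k) (n - k) / (n.factorial * k.factorial)) * X ^ k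

/-- The Jacobi polynomial
`P_n^{(α,β)}(η) = (α+1)_n / n! * ₂F₁(-n, n+α+β+1; α+1 | (1-η)/2)`.
The quotient `(α+1)_n / (α+1)_k` is written as `(α+1+k)_{n-k}`, so that the polynomial is defined
for all `α, β`. -/
def jacobiPoly (α β : ℂ) (n : ℕ) : ℂ[X] :=
  ∑ k ∈ Finset.range (n + 1),
    C (poch (-n) k * poch (n + α + β + 1) k * poch (α + 1 + k) (n - k)
      / (n.factorial * k.factorial)) * (C (1 / 2) * (1 - X)) ^ k

/-- The Bessel polynomial `y_n(η; a) = ₂F₀(-n, n+a+1; - | -η/2)`. -/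
def besselPoly (a : ℂ) (n : ℕ) : ℂ[X] :=
  ∑ k ∈ Finset.range (n + 1),
    C (poch (-n) k * poch (n + a + 1) k / k.factorial) * (C (-1 / 2) * X) ^ k

/-- The pseudo Jacobi polynomial
`P_n(η; ν, N) = (-2i)^n n! / (n-2N-1)_n * P_n^{(-N-1+iν, -N-1-iν)}(iη)`,
which is defined when `(n-2N-1)_n ≠ 0`. -/
def pseudoJacobiPoly (ν N : ℂ) (n : ℕ) : ℂ[X] :=
  C ((-2 * Complex.I) ^ n * n.factorial / poch (n - 2 * N - 1) n) *
    (jacobiPoly (-N - 1 + Complex.I * ν) (-N - 1 - Complex.I * ν) n).comp (C Complex.I * X)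

/-- The data of a family of orthogonal polynomials in ordinary quantum mechanics that enter the
relation: `m` is the degree of the polynomial `Φ`, and `Λ` is the space of parameters `λ`. -/
structure OQM (m : ℕ) (Λ : Type) where
  /-- the sinusoidal coordinate `η(x)` -/
  η : ℝ → ℝ
  /-- the shift `δ` of the parameters -/
  δ : Λ
  /-- the coefficient `c₂(η)` of the operator `-4 c₂(η) d²/dη² - 4 c₁(η; λ) d/dη` of which the
  polynomials are eigenfunctions -/
  c₂ : ℂ[X]
  /-- the constant `c_F` of the forward shift operator `c_F d/dη` -/
  cF : ℂ
  /-- the polynomials `P_n(η; λ)` -/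
  P : Λ → ℕ → ℂ[X]
  /-- the zeros `η_1, …, η_m` of `Φ`, each repeated according to its multiplicity -/
  zero : Fin m → ℂ

namespace OQM

variable {m : ℕ} {Λ : Type} (D : OQM m Λ)

/-- `P̌_n(x; λ) = P_n(η(x); λ)`. -/
def Pcheck (l : Λ) (n : ℕ) (x : ℝ) : ℂ := (D.P l n).eval (D.η x : ℂ)

/-- `c_n(λ)`, the coefficient of `η^n` in `P_n(η; λ)`. -/
def c (l : Λ) (n : ℕ) : ℂ := (D.P l n).coeff n

/-- The polynomial `Φ(η) = (4 / c_F²) c₂(η)`. -/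
def Phi : ℂ[X] := C (4 / D.cF ^ 2) * D.c₂

/-- `Φ̌(x) = (4 / c_F²) c₂(η(x))`. -/
def PhiCheck (x : ℝ) : ℂ := 4 / D.cF ^ 2 * D.c₂.eval (D.η x : ℂ)

/-- `c^Φ`, the leading coefficient of `Φ`. -/
def cPhi : ℂ := D.Phi.leadingCoeff

/-- The number of earlier occurrences of `η_j` in the list `η_1, …, η_m`: a zero of multiplicity
`r` gets the orders `0, 1, …, r - 1`. -/
def order (j : Fin m) : ℕ := (Finset.univ.filter fun i => i < j ∧ D.zero i = D.zero j).card

/-- The entry of the Christoffel determinants in the row `j` and in the column that belongs to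
`P_n`: the value of `P_n` at `η_j`, or of its derivative of order `order j` if `η_j` is a
repetition of an earlier zero. -/
def entry (l : Λ) (n : ℕ) (j : Fin m) : ℂ := (derivative^[D.order j] (D.P l n)).eval (D.zero j)

/-- The determinant of the rows above with the columns `P_{n+ℓ_1}, …, P_{n+ℓ_m}`. -/
def rawDet (l : Λ) (n : ℕ) (ℓ : Fin m → ℕ) : ℂ :=
  (Matrix.of fun j k => D.entry l (n + ℓ k) j).det

/-- `D_n^{(ℓ_1, …, ℓ_m)}(λ)`: the same determinant with each row divided by its entry for `P_n`. -/
def normDet (l : Λ) (n : ℕ) (ℓ : Fin m → ℕ) : ℂ :=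
  (Matrix.of fun j k => D.entry l (n + ℓ k) j / D.entry l n j).det

/-- The index tuple `(0, 1, …, m - 1)`. -/
def base (m : ℕ) : Fin m → ℕ := fun j => j

/-- The index tuple `(0, 1, …, m)` with `k` left out. -/
def skip {m : ℕ} (k : Fin (m + 1)) : Fin m → ℕ := fun j => k.succAbove j

/-- `α_{n,k}(λ)`, as a quotient of Christoffel determinants. Dividing the rows of both determinants
by common factors does not change it. -/
def alpha (l : Λ) (n : ℕ) (k : Fin (m + 1)) : ℂ :=
  (-1) ^ (m - (k : ℕ)) * D.rawDet l n (skip k) / D.rawDet l n (base m)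

/-- `β_n(λ) = c^Φ c_n(λ+δ) / c_{n+m}(λ)`. -/
def beta [Add Λ] (l : Λ) (n : ℕ) : ℂ := D.cPhi * D.c (l + D.δ) n / D.c l (n + m)

end OQM

/-- Laguerre, `λ = g`. -/
def laguerre : OQM 1 ℝ where
  η x := x ^ 2
  δ := 1
  c₂ := X
  cF := 2
  P g n := laguerrePoly (g - 1 / 2) n
  zero := ![0]

/-- Jacobi, `λ = (g, h)`. -/
def jacobi : OQM 2 (ℝ × ℝ) where
  η x := Real.cos (2 * x)
  δ := (1, 1)
  c₂ := 1 - X ^ 2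
  cF := -4
  P l n := jacobiPoly (l.1 - 1 / 2) (l.2 - 1 / 2) n
  zero := ![1, -1]

/-- Bessel, `λ = h`. -/
def bessel : OQM 2 ℝ where
  η x := Real.exp x
  δ := -1
  c₂ := C (1 / 4) * X ^ 2
  cF := 1
  P h n := besselPoly (-2 * h - 1) n
  zero := ![0, 0]

/-- Pseudo Jacobi, `λ = (h, μ)`. -/
def pseudoJacobi : OQM 2 (ℝ × ℝ) where
  η x := Real.sinh x
  δ := (-1, 0)
  c₂ := C (1 / 4) * (1 + X ^ 2)
  cF := 1
  P l n := pseudoJacobiPoly (-l.2) (l.1 - 1 / 2) n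
  zero := ![Complex.I, -Complex.I]

/-- Closed forms of `α_{n,0}, α_{n,1}` for Laguerre. -/
def laguerreAlpha (g : ℝ) (n : ℕ) : Fin 2 → ℝ :=
  ![-((n + g + 1 / 2) / (n + 1)), 1]

/-- Closed form of `β_n` for Laguerre. -/
def laguerreBeta (n : ℕ) : ℝ := -(n + 1)

/-- Closed forms of `α_{n,0}, α_{n,1}, α_{n,2}` for Jacobi. -/
def jacobiAlpha (g h : ℝ) (n : ℕ) : Fin 3 → ℝ :=
  ![-((n + g + 1 / 2) * (n + h + 1 / 2) * (2 * n + g + h + 3)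
      / ((n + 1) * (n + 2) * (2 * n + g + h + 1))),
    -((g - h) * (2 * n + g + h + 2) / ((n + 2) * (2 * n + g + h + 1))),
    1]

/-- Closed form of `β_n` for Jacobi. -/
def jacobiBeta (g h : ℝ) (n : ℕ) : ℝ :=
  -((n + 1) * (n + 2) / ((2 * n + g + h + 2) * (2 * n + g + h + 3)))

/-- Closed forms of `α_{n,0}, α_{n,1}, α_{n,2}` for Bessel. -/
def besselAlpha (h : ℝ) (n : ℕ) : Fin 3 → ℝ :=
  ![(2 * n - 2 * h + 3) / (2 * n - 2 * h + 1),
    -(4 * (n - h + 1) / (2 * n - 2 * h + 1)),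
    1]

/-- Closed form of `β_n` for Bessel. -/
def besselBeta (h : ℝ) (n : ℕ) : ℝ :=
  4 / ((2 * n - 2 * h + 2) * (2 * n - 2 * h + 3))

/-- Closed forms of `α_{n,0}, α_{n,1}, α_{n,2}` for pseudo Jacobi. -/
def pseudoJacobiAlpha (h μ : ℝ) (n : ℕ) : Fin 3 → ℝ :=
  ![(2 * h - n - 1) * (2 * h - n) * ((2 * h - 2 * n - 1) ^ 2 + 4 * μ ^ 2)
      / (4 * ((h - n - 1) * (h - n)) * (2 * h - 2 * n - 1) ^ 2),
    -(4 * μ * (2 * h - n - 1) / ((2 * h - 2 * n - 1) * (2 * h - 2 * n - 3))),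
    1]

end

/-! This is Christoffel's formula made explicit. Everything rests on one-step contiguous relations:
multiplying a polynomial with one parameter raised by a linear factor gives a combination of two
neighbouring polynomials with the original parameter (`X_mul_laguerrePoly`, `X_mul_jacobiAux`,
`one_sub_X_mul_jacobiAux`, `X_mul_besselPoly`). They are checked coefficient by coefficient.
Laguerre needs one such step. For Jacobi a step in β followed by steps in α gives Φ times the
shifted polynomial, and Bessel uses two steps in its single parameter. Pseudo Jacobi is Jacobi at iη
with explicit normalization constants. With denominators cleared these identities hold for all
parameters; dividing gives the closed forms and part (B).

For part (A), let A_k be the explicit coefficients, normalized by A_m = 1. At the zeros of Φ the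
left side vanishes, so the A_k solve m homogeneous equations in the values there, and Cramer's rule
identifies them with the determinant quotients once the base determinant is nonzero. This
nonvanishing comes from the one-step relations too: at an endpoint the left side drops out, leaving
the ratio of consecutive values, and the determinant is a nonzero constant times (2n+α+β+2) P_n(1)
P_n(-1). At the double zero of Bessel the value and derivative are computed directly. Finally β_n is
a quotient of leading coefficients. -/

/-! ### Pochhammer symbols and coefficient extraction -/

theorem poch_zero (a : ℂ) : poch a 0 = 1 := by simp [poch]

theorem poch_succ (a : ℂ) (k : ℕ) : poch a (k + 1) = poch a k * (a + k) := by
  simp [poch, ascPochhammer_succ_eval]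

theorem poch_succ_left (a : ℂ) (k : ℕ) : poch a (k + 1) = a * poch (a + 1) k := by
  simp [poch, ascPochhammer_succ_left, eval_comp]

theorem poch_ne_zero {a : ℂ} {k : ℕ} (h : ∀ j : ℕ, j < k → a + j ≠ 0) : poch a k ≠ 0 := by
  induction k with
  | zero => simp [poch_zero]
  | succ k ih =>
    rw [poch_succ]
    exact mul_ne_zero (ih fun j hj => h j (by omega)) (h k (by omega))

theorem poch_neg_natCast_of_lt {n k : ℕ} (h : n < k) : poch (-n) k = 0 := by
  induction k with
  | zero => omega
  | succ k ih =>
    rw [poch_succ]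
    rcases Nat.lt_succ_iff_lt_or_eq.mp h with h | h
    · rw [ih h, zero_mul]
    · rw [h]; ring

theorem poch_neg_natCast_self (n : ℕ) : poch (-n) n = (-1) ^ n * n.factorial := by
  induction n with
  | zero => simp [poch_zero]
  | succ n ih =>
    rw [poch_succ_left, Nat.factorial_succ]
    have : (-((n + 1 : ℕ) : ℂ) + 1) = -n := by push_cast; ring
    rw [this, ih]; push_cast; ring

/-- The last factor of `(a)_{n-k}` splits off in the presence of `(-n)_{k+1}`. -/
theorem poch_neg_mul_poch_sub (a : ℂ) (n k : ℕ) :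
    poch (-n) (k + 1) * poch a (n - k) =
      poch (-n) (k + 1) * poch a (n - (k + 1)) * (a + n - k - 1) := by
  rcases lt_or_ge k n with h | h
  · obtain ⟨d, rfl⟩ := Nat.exists_eq_add_of_lt h
    rw [show k + d + 1 - k = d + 1 by omega, show k + d + 1 - (k + 1) = d by omega,
      poch_succ a]
    push_cast; ring
  -- Here the natural subtractions truncate, but the common factor (-n)_{k+1} is zero.
  · rw [poch_neg_natCast_of_lt (by omega)]; ring

theorem poch_neg_natCast_succ (n k : ℕ) :
    poch (-((n + 1 : ℕ) : ℂ)) (k + 1) = -(n + 1) * poch (-n) k := by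
  rw [poch_succ_left]
  have : (-((n + 1 : ℕ) : ℂ) + 1) = -n := by push_cast; ring
  rw [this]; push_cast; ring

theorem coeff_sum_range_C_mul_X_pow (f : ℕ → ℂ) (n k : ℕ) (hf : n < k → f k = 0) :
    (∑ i ∈ Finset.range (n + 1), C (f i) * X ^ i : ℂ[X]).coeff k = f k := by
  simp only [finsetSum_coeff, coeff_C_mul_X_pow, Finset.sum_ite_eq, Finset.mem_range]
  split_ifs with h
  · rfl
  · exact (hf (by omega)).symm

/-! ### Laguerre polynomials -/

theorem coeff_laguerrePoly (α : ℂ) (n k : ℕ) : (laguerrePoly α n).coeff k =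
    poch (-n) k * poch (α + 1 + k) (n - k) / (n.factorial * k.factorial) := by
  rw [laguerrePoly, coeff_sum_range_C_mul_X_pow]
  intro h
  rw [poch_neg_natCast_of_lt h]; simp

/-- The combination on the right has no constant term. In degree k + 1 all three terms contain the
same Pochhammer symbols, up to the one factor split off by `poch_neg_mul_poch_sub`. -/
theorem X_mul_laguerrePoly (α : ℂ) (n : ℕ) :
    X * laguerrePoly (α + 1) n =
      C (n + α + 1) * laguerrePoly α n - C (n + 1 : ℂ) * laguerrePoly α (n + 1) := by
  have hn : ((n.factorial : ℕ) : ℂ) ≠ 0 := by exact_mod_cast n.factorial_ne_zero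
  have hn1 : (n + 1 : ℂ) ≠ 0 := by exact_mod_cast n.succ_ne_zero
  ext k
  rcases k with _ | k
  · simp only [coeff_X_mul_zero, coeff_sub, coeff_C_mul, coeff_laguerrePoly, poch_zero,
      Nat.sub_zero, poch_succ, Nat.factorial_succ]
    push_cast
    field_simp
    simp only [Nat.factorial_zero, Nat.cast_one]
    ring
  · have hk : ((k.factorial : ℕ) : ℂ) ≠ 0 := by exact_mod_cast k.factorial_ne_zero
    have hk1 : (k + 1 : ℂ) ≠ 0 := by exact_mod_cast k.succ_ne_zero
    have h1 := poch_neg_mul_poch_sub (α + 2 + k) n k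
    rw [poch_succ] at h1
    simp only [coeff_X_mul, coeff_sub, coeff_C_mul, coeff_laguerrePoly, poch_neg_natCast_succ,
      Nat.factorial_succ, Nat.add_sub_add_right]
    rw [poch_succ (-n)]
    have e1 : α + 1 + 1 + k = α + 2 + k := by ring
    have e2 : α + 1 + ((k + 1 : ℕ) : ℂ) = α + 2 + k := by push_cast; ring
    rw [e1, e2]
    push_cast
    field_simp
    linear_combination h1

/-! ### Jacobi polynomials -/

/-- The Jacobi polynomial as a polynomial in `(1 - η) / 2`. -/
noncomputable def jacobiAux (α β : ℂ) (n : ℕ) : ℂ[X] :=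
  ∑ k ∈ Finset.range (n + 1),
    C (poch (-n) k * poch (n + α + β + 1) k * poch (α + 1 + k) (n - k)
      / (n.factorial * k.factorial)) * X ^ k

theorem jacobiPoly_eq_comp (α β : ℂ) (n : ℕ) :
    jacobiPoly α β n = (jacobiAux α β n).comp (C (1 / 2) * (1 - X)) := by
  simp only [jacobiPoly, jacobiAux, comp, eval₂_finsetSum, eval₂_mul, eval₂_C, eval₂_X_pow]

theorem coeff_jacobiAux (α β : ℂ) (n k : ℕ) : (jacobiAux α β n).coeff k =
    poch (-n) k * poch (n + α + β + 1) k * poch (α + 1 + k) (n - k)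
      / (n.factorial * k.factorial) := by
  rw [jacobiAux, coeff_sum_range_C_mul_X_pow]
  intro h
  rw [poch_neg_natCast_of_lt h]; simp

theorem X_mul_jacobiAux (α β : ℂ) (n : ℕ) :
    C (2 * n + α + β + 2) * (X * jacobiAux (α + 1) β n) =
      C (n + α + 1) * jacobiAux α β n - C (n + 1 : ℂ) * jacobiAux α β (n + 1) := by
  have hn : ((n.factorial : ℕ) : ℂ) ≠ 0 := by exact_mod_cast n.factorial_ne_zero
  have hn1 : (n + 1 : ℂ) ≠ 0 := by exact_mod_cast n.succ_ne_zero
  ext k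
  rcases k with _ | k
  · simp only [coeff_C_mul, coeff_X_mul_zero, coeff_sub, coeff_jacobiAux, poch_zero,
      Nat.sub_zero, poch_succ, Nat.factorial_succ]
    push_cast
    field_simp
    simp only [Nat.factorial_zero, Nat.cast_one]
    ring
  · have hk : ((k.factorial : ℕ) : ℂ) ≠ 0 := by exact_mod_cast k.factorial_ne_zero
    have hk1 : (k + 1 : ℂ) ≠ 0 := by exact_mod_cast k.succ_ne_zero
    have h1 := poch_neg_mul_poch_sub (α + 2 + k) n k
    rw [poch_succ] at h1
    simp only [coeff_C_mul, coeff_X_mul, coeff_sub, coeff_jacobiAux, poch_neg_natCast_succ,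
      Nat.factorial_succ, Nat.add_sub_add_right]
    rw [poch_succ (-n), poch_succ_left (n + α + β + 1), poch_succ]
    have e1 : α + 1 + 1 + k = α + 2 + k := by ring
    have e2 : α + 1 + ((k + 1 : ℕ) : ℂ) = α + 2 + k := by push_cast; ring
    have e3 : ((n + 1 : ℕ) : ℂ) + α + β + 1 = n + α + β + 1 + 1 := by push_cast; ring
    have e4 : n + (α + 1) + β + 1 = n + α + β + 1 + 1 := by ring
    rw [e1, e2, e3, e4]
    push_cast
    field_simp
    linear_combination (n + α + β + 1) * poch (n + α + β + 1 + 1) k * h1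

/-- Companion of `X_mul_jacobiAux` at the other endpoint: the variable is t = (1-η)/2, so 1 - t =
(1+η)/2 goes with β as t goes with α. -/
theorem one_sub_X_mul_jacobiAux (α β : ℂ) (n : ℕ) :
    C (2 * n + α + β + 2) * ((1 - X) * jacobiAux α (β + 1) n) =
      C (n + β + 1) * jacobiAux α β n + C (n + 1 : ℂ) * jacobiAux α β (n + 1) := by
  have hn : ((n.factorial : ℕ) : ℂ) ≠ 0 := by exact_mod_cast n.factorial_ne_zero
  have hn1 : (n + 1 : ℂ) ≠ 0 := by exact_mod_cast n.succ_ne_zero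
  ext k
  rcases k with _ | k
  · simp only [coeff_C_mul, sub_mul, one_mul, coeff_X_mul_zero, coeff_sub, coeff_add,
      coeff_jacobiAux, poch_zero, Nat.sub_zero, poch_succ, Nat.factorial_succ]
    push_cast
    field_simp
    simp only [Nat.factorial_zero, Nat.cast_one]
    ring
  · have hk : ((k.factorial : ℕ) : ℂ) ≠ 0 := by exact_mod_cast k.factorial_ne_zero
    have hk1 : (k + 1 : ℂ) ≠ 0 := by exact_mod_cast k.succ_ne_zero
    simp only [coeff_C_mul, sub_mul, one_mul, coeff_X_mul, coeff_sub, coeff_add, coeff_jacobiAux,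
      poch_neg_natCast_succ, Nat.factorial_succ, Nat.add_sub_add_right]
    rw [poch_succ (-n), poch_succ_left (n + α + β + 1), poch_succ, poch_succ]
    have e1 : α + 1 + ((k + 1 : ℕ) : ℂ) = α + 1 + k + 1 := by push_cast; ring
    have e3 : ((n + 1 : ℕ) : ℂ) + α + β + 1 = n + α + β + 1 + 1 := by push_cast; ring
    have e4 : n + α + (β + 1) + 1 = n + α + β + 1 + 1 := by ring
    rw [e1, e3, e4]
    -- Below n the Pochhammer symbols of lengths n-k and n-k-1 reduce to a common one. At k = n the
    -- truncated length occurs only next to the factor -n + k = 0, and above n everything vanishes.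
    rcases lt_trichotomy k n with h | rfl | h
    · obtain ⟨d, rfl⟩ := Nat.exists_eq_add_of_lt h
      rw [show k + d + 1 - k = d + 1 by omega, show k + d + 1 - (k + 1) = d by omega,
        poch_succ_left (α + 1 + k), poch_succ (α + 1 + k + 1)]
      push_cast at hn1 ⊢
      field_simp
      ring
    · simp only [Nat.sub_self, poch_zero]
      push_cast
      field_simp
      ring
    · rw [poch_neg_natCast_of_lt h]; simp

/-- Lower β first, at α + 1; this leaves degrees n and n + 1, and the factor X then lowers α in
each. The two contributions in degree n + 1 combine to the factor α - β. -/
theorem X_mul_one_sub_X_mul_jacobiAux (α β : ℂ) (n : ℕ) :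
    C ((2 * n + α + β + 2) * (2 * n + α + β + 3) * (2 * n + α + β + 4)) *
        (X * (1 - X) * jacobiAux (α + 1) (β + 1) n) =
      C ((n + α + 1) * (n + β + 1) * (2 * n + α + β + 4)) * jacobiAux α β n +
      C ((n + 1) * (α - β) * (2 * n + α + β + 3)) * jacobiAux α β (n + 1) -
      C ((n + 1) * (n + 2) * (2 * n + α + β + 2)) * jacobiAux α β (n + 2) := by
  have h1 := one_sub_X_mul_jacobiAux (α + 1) β n
  have h2 := X_mul_jacobiAux α β n
  have h3 := X_mul_jacobiAux α β (n + 1)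
  simp only [map_add, map_mul, map_sub, map_natCast, map_one, map_ofNat, Nat.cast_add,
    Nat.cast_one] at *
  linear_combination (2 * n + C α + C β + 2) * (2 * n + C α + C β + 4) * X * h1 +
    (2 * n + C α + C β + 4) * (n + C β + 1) * h2 + (2 * n + C α + C β + 2) * (n + 1) * h3

/-- At t = 0 the left side of `X_mul_jacobiAux` vanishes. Together with the analogue at t = 1 this
yields the endpoint values by induction, with no summation formula. -/
theorem eval_zero_jacobiAux_succ (α β : ℂ) (n : ℕ) :
    (n + 1 : ℂ) * (jacobiAux α β (n + 1)).eval 0 = (n + α + 1) * (jacobiAux α β n).eval 0 := by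
  have := congrArg (eval 0) (X_mul_jacobiAux α β n)
  simp at this
  linear_combination this

theorem eval_one_jacobiAux_succ (α β : ℂ) (n : ℕ) :
    (n + 1 : ℂ) * (jacobiAux α β (n + 1)).eval 1 = -(n + β + 1) * (jacobiAux α β n).eval 1 := by
  have := congrArg (eval 1) (one_sub_X_mul_jacobiAux α β n)
  simp at this
  linear_combination -this

theorem eval_zero_jacobiAux (α β : ℂ) (n : ℕ) :
    (jacobiAux α β n).eval 0 = poch (α + 1) n / n.factorial := by
  induction n with
  | zero => simp [jacobiAux, poch_zero]
  | succ n ih =>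
    have hn1 : (n + 1 : ℂ) ≠ 0 := by exact_mod_cast n.succ_ne_zero
    apply mul_left_cancel₀ hn1
    rw [eval_zero_jacobiAux_succ, ih, poch_succ, Nat.factorial_succ]
    push_cast; field_simp; ring

theorem eval_one_jacobiAux (α β : ℂ) (n : ℕ) :
    (jacobiAux α β n).eval 1 = (-1) ^ n * poch (β + 1) n / n.factorial := by
  induction n with
  | zero => simp [jacobiAux, poch_zero]
  | succ n ih =>
    have hn1 : (n + 1 : ℂ) ≠ 0 := by exact_mod_cast n.succ_ne_zero
    apply mul_left_cancel₀ hn1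
    rw [eval_one_jacobiAux_succ, ih, poch_succ, Nat.factorial_succ]
    push_cast; field_simp; ring

theorem jacobiAux_natDegree_le (α β : ℂ) (n : ℕ) : (jacobiAux α β n).natDegree ≤ n := by
  rw [natDegree_le_iff_coeff_eq_zero]
  intro k hk
  rw [coeff_jacobiAux, poch_neg_natCast_of_lt hk]; simp

/-- Since q is at most linear, only the degree n term of p reaches degree n. This gives leading
coefficients under the substitutions (1-η)/2 and iη. -/
theorem coeff_comp_of_natDegree_le {p q : ℂ[X]} {n : ℕ} (hp : p.natDegree ≤ n)
    (hq : q.natDegree ≤ 1) : (p.comp q).coeff n = p.coeff n * q.coeff 1 ^ n := by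
  rw [comp, eval₂_eq_sum_range' C (Nat.lt_succ_of_le hp), finsetSum_coeff,
    Finset.sum_range_succ, Finset.sum_eq_zero, zero_add, coeff_C_mul]
  · congr 1
    simpa using coeff_pow_of_natDegree_le (m := n) hq
  · intro k hk
    rw [coeff_C_mul, coeff_eq_zero_of_natDegree_lt (p := q ^ k), mul_zero]
    calc (q ^ k).natDegree ≤ k * q.natDegree := natDegree_pow_le
      _ ≤ k * 1 := by gcongr
      _ < n := by simpa using hk

theorem coeff_jacobiPoly_self (α β : ℂ) (n : ℕ) :
    (jacobiPoly α β n).coeff n = poch (n + α + β + 1) n / (2 ^ n * n.factorial) := by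
  have hn : ((n.factorial : ℕ) : ℂ) ≠ 0 := by exact_mod_cast n.factorial_ne_zero
  rw [jacobiPoly_eq_comp, coeff_comp_of_natDegree_le (jacobiAux_natDegree_le α β n)
    (by compute_degree), coeff_jacobiAux, poch_neg_natCast_self]
  have : (C (1 / 2) * (1 - X) : ℂ[X]).coeff 1 = -(1 / 2) := by
    rw [coeff_C_mul]; simp [coeff_one]
  rw [this, Nat.sub_self, poch_zero, neg_pow (1 / 2 : ℂ)]
  have h2 : ((-1 : ℂ) ^ n) * (-1) ^ n = 1 := by rw [← mul_pow]; simp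
  have h3 : (2 : ℂ) ^ n ≠ 0 := pow_ne_zero n two_ne_zero
  rw [one_div, inv_pow]
  field_simp
  linear_combination poch (n + α + β + 1) n * h2

theorem jacobiPoly_natDegree_le (α β : ℂ) (n : ℕ) : (jacobiPoly α β n).natDegree ≤ n := by
  rw [jacobiPoly_eq_comp]
  calc _ ≤ (jacobiAux α β n).natDegree * (C (1 / 2) * (1 - X) : ℂ[X]).natDegree :=
        natDegree_comp_le
    _ ≤ n * 1 := Nat.mul_le_mul (jacobiAux_natDegree_le α β n) (by compute_degree)
    _ = n := mul_one n

theorem one_sub_X_sq_mul_jacobiPoly (α β : ℂ) (n : ℕ) :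
    C ((2 * n + α + β + 2) * (2 * n + α + β + 3) * (2 * n + α + β + 4)) *
        (C (1 / 4) * (1 - X ^ 2) * jacobiPoly (α + 1) (β + 1) n) =
      C ((n + α + 1) * (n + β + 1) * (2 * n + α + β + 4)) * jacobiPoly α β n +
      C ((n + 1) * (α - β) * (2 * n + α + β + 3)) * jacobiPoly α β (n + 1) -
      C ((n + 1) * (n + 2) * (2 * n + α + β + 2)) * jacobiPoly α β (n + 2) := by
  have h := congrArg (fun p => p.comp (C (1 / 2) * (1 - X)))
    (X_mul_one_sub_X_mul_jacobiAux α β n)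
  simp only [mul_comp, add_comp, sub_comp, C_comp, X_comp, one_comp, ← jacobiPoly_eq_comp] at h
  rw [← h]
  have h4 : (C (1 / 4) : ℂ[X]) = C (1 / 2) * C (1 / 2) := by rw [← C_mul]; norm_num
  have h2 : (C (1 / 2) : ℂ[X]) * 2 = 1 := by
    rw [show (2 : ℂ[X]) = C 2 from rfl, ← C_mul]; norm_num
  rw [h4]
  linear_combination (C ((2 * n + α + β + 2) * (2 * n + α + β + 3) * (2 * n + α + β + 4)) *
    jacobiPoly (α + 1) (β + 1) n * C (1 / 2) * (1 - X)) * h2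

theorem eval_jacobiPoly (α β x : ℂ) (n : ℕ) :
    (jacobiPoly α β n).eval x = (jacobiAux α β n).eval (1 / 2 * (1 - x)) := by
  simp [jacobiPoly_eq_comp, eval_comp]

theorem eval_one_jacobiPoly (α β : ℂ) (n : ℕ) :
    (jacobiPoly α β n).eval 1 = poch (α + 1) n / n.factorial := by
  rw [eval_jacobiPoly, ← eval_zero_jacobiAux α β]; norm_num

theorem eval_neg_one_jacobiPoly (α β : ℂ) (n : ℕ) :
    (jacobiPoly α β n).eval (-1) = (-1) ^ n * poch (β + 1) n / n.factorial := by
  rw [eval_jacobiPoly, ← eval_one_jacobiAux α β]; norm_num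

/-! ### Bessel polynomials -/

theorem coeff_besselPoly (a : ℂ) (n k : ℕ) : (besselPoly a n).coeff k =
    poch (-n) k * poch (n + a + 1) k / k.factorial * (-1 / 2) ^ k := by
  have : besselPoly a n = ∑ k ∈ Finset.range (n + 1),
      C (poch (-n) k * poch (n + a + 1) k / k.factorial * (-1 / 2) ^ k) * X ^ k := by
    refine Finset.sum_congr rfl fun k _ => ?_
    rw [mul_pow, ← C_pow, ← mul_assoc, ← C_mul]
  rw [this, coeff_sum_range_C_mul_X_pow]
  intro h
  rw [poch_neg_natCast_of_lt h]; simp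

/-- All Bessel polynomials have constant term 1, so the difference of two neighbours is divisible by
X. -/
theorem X_mul_besselPoly (a : ℂ) (n : ℕ) :
    C (2 * n + a + 2) * (X * besselPoly (a + 1) n) =
      C 2 * (besselPoly a (n + 1) - besselPoly a n) := by
  ext k
  rcases k with _ | k
  · simp [coeff_besselPoly, poch_zero]
  · have hk : ((k.factorial : ℕ) : ℂ) ≠ 0 := by exact_mod_cast k.factorial_ne_zero
    have hk1 : (k + 1 : ℂ) ≠ 0 := by exact_mod_cast k.succ_ne_zero
    simp only [coeff_C_mul, coeff_X_mul, coeff_sub, coeff_besselPoly, poch_neg_natCast_succ,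
      Nat.factorial_succ]
    rw [poch_succ (-n), poch_succ_left (n + a + 1), poch_succ]
    have e3 : ((n + 1 : ℕ) : ℂ) + a + 1 = n + a + 1 + 1 := by push_cast; ring
    have e4 : n + (a + 1) + 1 = n + a + 1 + 1 := by ring
    rw [e3, e4, pow_succ]
    push_cast
    field_simp
    ring

theorem X_sq_mul_besselPoly (a : ℂ) (n : ℕ) :
    C ((2 * n + a + 2) * (2 * n + a + 3) * (2 * n + a + 4)) * (X ^ 2 * besselPoly (a + 2) n) =
      C (4 * (2 * n + a + 2)) * besselPoly a (n + 2) -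
      C (4 * (2 * (2 * n + a + 3))) * besselPoly a (n + 1) +
      C (4 * (2 * n + a + 4)) * besselPoly a n := by
  have h1 := X_mul_besselPoly (a + 1) n
  have h2 := X_mul_besselPoly a n
  have h3 := X_mul_besselPoly a (n + 1)
  rw [show a + 1 + 1 = a + 2 by ring] at h1
  simp only [map_add, map_mul, map_natCast, map_one, map_ofNat, Nat.cast_add,
    Nat.cast_one] at *
  linear_combination (2 * n + C a + 2) * (2 * n + C a + 4) * X * h1 -
    2 * (2 * n + C a + 4) * h2 + 2 * (2 * n + C a + 2) * h3

/-- The ratios P_{n+1}/P_n at 1 and -1 are (n+α+1)/(n+1) and -(n+β+1)/(n+1); their difference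
evaluates the base determinant and shows when it is nonzero. The form here is free of divisions. -/
theorem eval_one_mul_eval_neg_one_jacobiPoly (α β : ℂ) (n : ℕ) :
    (n + 1 : ℂ) * ((jacobiPoly α β n).eval (-1) * (jacobiPoly α β (n + 1)).eval 1 -
      (jacobiPoly α β (n + 1)).eval (-1) * (jacobiPoly α β n).eval 1) =
    (2 * n + α + β + 2) * ((jacobiPoly α β n).eval 1 * (jacobiPoly α β n).eval (-1)) := by
  have h0 := eval_zero_jacobiAux_succ α β n
  have h1 := eval_one_jacobiAux_succ α β n
  have e1 : (1 / 2 * (1 - 1) : ℂ) = 0 := by norm_num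
  have e2 : (1 / 2 * (1 - -1) : ℂ) = 1 := by norm_num
  simp only [eval_jacobiPoly, e1, e2]
  linear_combination (jacobiAux α β n).eval 1 * h0 - (jacobiAux α β n).eval 0 * h1

/-! ### Christoffel determinants and Cramer's rule -/

namespace OQM

variable {m : ℕ} {Λ : Type} (D : OQM m Λ)

theorem PhiCheck_eq_eval (x : ℝ) : D.PhiCheck x = D.Phi.eval (D.η x : ℂ) := by
  simp [PhiCheck, Phi]

variable {D}

theorem cPhi_eq {a : ℂ} (h : D.Phi = C a * ∏ j, (X - C (D.zero j))) : D.cPhi = a := by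
  rw [cPhi, h, leadingCoeff_mul, leadingCoeff_C,
    (monic_prod_of_monic _ _ fun j _ => monic_X_sub_C (D.zero j)).leadingCoeff, mul_one]

theorem order_eq_zero (h : Function.Injective D.zero) (j : Fin m) : D.order j = 0 := by
  rw [order, Finset.card_eq_zero, Finset.filter_eq_empty_iff]
  rintro i - ⟨hlt, he⟩
  exact hlt.ne (h he)

theorem entry_eq_eval (h : Function.Injective D.zero) (l : Λ) (n : ℕ) (j : Fin m) :
    D.entry l n j = (D.P l n).eval (D.zero j) := by
  rw [entry, order_eq_zero h, Function.iterate_zero, id]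

theorem eval_relation {l l' : Λ} {n : ℕ} {b : ℂ} {A : Fin (m + 1) → ℂ}
    (h : D.Phi * D.P l' n = C b * ∑ k : Fin (m + 1), C (A k) * D.P l (n + k)) (x : ℝ) :
    D.PhiCheck x * D.Pcheck l' n x = b * ∑ k : Fin (m + 1), A k * D.Pcheck l (n + k) x := by
  have := congrArg (eval (D.η x : ℂ)) h
  simpa only [eval_mul, eval_C, eval_finsetSum, PhiCheck_eq_eval, Pcheck] using this

/-- Φ vanishes at each η_j, and b ≠ 0 can be cancelled. Distinct zeros are required so that every
entry is a plain value rather than a derivative. -/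
theorem sum_mul_entry_eq_zero (hinj : Function.Injective D.zero)
    (hΦ : D.Phi = C D.cPhi * ∏ j, (X - C (D.zero j))) {l l' : Λ} {n : ℕ} {b : ℂ} (hb : b ≠ 0)
    {A : Fin (m + 1) → ℂ}
    (h : D.Phi * D.P l' n = C b * ∑ k : Fin (m + 1), C (A k) * D.P l (n + k)) (j : Fin m) :
    ∑ k : Fin (m + 1), A k * D.entry l (n + k) j = 0 := by
  have h0 : D.Phi.eval (D.zero j) = 0 := by
    rw [hΦ, eval_mul, eval_prod, Finset.prod_eq_zero (Finset.mem_univ j) (by simp), mul_zero]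
  have := congrArg (eval (D.zero j)) h
  simp only [eval_mul, eval_C, eval_finsetSum, h0, zero_mul] at this
  simp only [entry_eq_eval hinj]
  exact (mul_eq_zero.mp this.symm).resolve_left hb

/-- The row factors do not depend on the chosen columns, so they cancel in the quotients that define
α_{n,k}. -/
theorem normDet_eq (l : Λ) (n : ℕ) (ℓ : Fin m → ℕ) :
    D.normDet l n ℓ = (∏ j, (D.entry l n j)⁻¹) * D.rawDet l n ℓ := by
  rw [rawDet, ← Matrix.det_mul_column, normDet]
  congr 1
  ext j k
  simp [div_eq_inv_mul]

theorem normDet_ne_zero {l : Λ} {n : ℕ} {ℓ : Fin m → ℕ} (h : ∀ j, D.entry l n j ≠ 0)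
    (hdet : D.rawDet l n ℓ ≠ 0) : D.normDet l n ℓ ≠ 0 := by
  rw [normDet_eq]
  exact mul_ne_zero (Finset.prod_ne_zero_iff.mpr fun j _ => inv_ne_zero (h j)) hdet

theorem alpha_eq_normDet {l : Λ} {n : ℕ} (h : ∀ j, D.entry l n j ≠ 0) (k : Fin (m + 1)) :
    D.alpha l n k =
      (-1) ^ (m - (k : ℕ)) * (D.normDet l n (skip k) / D.normDet l n (base m)) := by
  rw [normDet_eq, normDet_eq, mul_div_mul_left, alpha, mul_div_assoc]
  exact Finset.prod_ne_zero_iff.mpr fun j _ => inv_ne_zero (h j)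

theorem rawDet_one (D : OQM 1 Λ) (l : Λ) (n : ℕ) (ℓ : Fin 1 → ℕ) :
    D.rawDet l n ℓ = D.entry l (n + ℓ 0) 0 := by
  simp [rawDet]

theorem rawDet_two (D : OQM 2 Λ) (l : Λ) (n : ℕ) (ℓ : Fin 2 → ℕ) :
    D.rawDet l n ℓ = D.entry l (n + ℓ 0) 0 * D.entry l (n + ℓ 1) 1 -
      D.entry l (n + ℓ 1) 0 * D.entry l (n + ℓ 0) 1 := by
  simp [rawDet, Matrix.det_fin_two]

/-- The Cramer rule for `m = 1`. -/
theorem alpha_eq_of_sum_eq_zero_one {D : OQM 1 Λ} {l : Λ} {n : ℕ} {A : Fin 2 → ℂ}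
    (hA : A 1 = 1) (h : ∀ j, ∑ k : Fin 2, A k * D.entry l (n + k) j = 0)
    (hdet : D.rawDet l n (base 1) ≠ 0) (k : Fin 2) : D.alpha l n k = A k := by
  have h0 := h 0
  have s0 : (Fin.succAbove (0 : Fin 2) (0 : Fin 1) : ℕ) = 1 := rfl
  have s1 : (Fin.succAbove (1 : Fin 2) (0 : Fin 1) : ℕ) = 0 := rfl
  rw [alpha, div_eq_iff hdet]
  simp only [Fin.sum_univ_two, hA, rawDet_one, base, skip, Fin.val_zero, Fin.val_one] at h0 ⊢
  fin_cases k
  · simp only [Fin.zero_eta, s0]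
    linear_combination -h0
  · simp only [Fin.mk_one, s1, hA]
    ring

/-- The Cramer rule for `m = 2`. -/
theorem alpha_eq_of_sum_eq_zero_two {D : OQM 2 Λ} {l : Λ} {n : ℕ} {A : Fin 3 → ℂ}
    (hA : A 2 = 1) (h : ∀ j, ∑ k : Fin 3, A k * D.entry l (n + k) j = 0)
    (hdet : D.rawDet l n (base 2) ≠ 0) (k : Fin 3) : D.alpha l n k = A k := by
  have h0 := h 0
  have h1 := h 1
  rw [alpha, div_eq_iff hdet]
  have s00 : (Fin.succAbove (0 : Fin 3) (0 : Fin 2) : ℕ) = 1 := rfl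
  have s01 : (Fin.succAbove (0 : Fin 3) (1 : Fin 2) : ℕ) = 2 := rfl
  have s10 : (Fin.succAbove (1 : Fin 3) (0 : Fin 2) : ℕ) = 0 := rfl
  have s11 : (Fin.succAbove (1 : Fin 3) (1 : Fin 2) : ℕ) = 2 := rfl
  have s20 : (Fin.succAbove (2 : Fin 3) (0 : Fin 2) : ℕ) = 0 := rfl
  have s21 : (Fin.succAbove (2 : Fin 3) (1 : Fin 2) : ℕ) = 1 := rfl
  simp only [Fin.sum_univ_three, hA, rawDet_two, base, skip, Fin.val_zero, Fin.val_one,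
    Fin.val_two] at h0 h1 ⊢
  fin_cases k
  · simp only [Fin.zero_eta, s00, s01]
    -- This eliminates A 1 from the two equations; the next case eliminates A 0.
    linear_combination D.entry l (n + 1) 0 * h1 - D.entry l (n + 1) 1 * h0
  · simp only [Fin.mk_one, s10, s11]
    linear_combination D.entry l (n + 0) 1 * h0 - D.entry l (n + 0) 0 * h1
  · simp only [Fin.reduceFinMk, s20, s21, hA]
    ring

end OQM

/-! ### Laguerre -/

theorem laguerre_Phi : laguerre.Phi = C 1 * ∏ j, (X - C (laguerre.zero j)) := by
  simp only [OQM.Phi, laguerre, Finset.univ_unique, Finset.prod_singleton]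
  norm_num

theorem laguerre_relation (g : ℝ) (n : ℕ) :
    laguerre.Phi * laguerre.P (g + laguerre.δ) n =
      C (laguerreBeta n : ℂ) *
        ∑ k : Fin 2, C (laguerreAlpha g n k : ℂ) * laguerre.P g (n + k) := by
  have hn1 : (n + 1 : ℂ) ≠ 0 := by exact_mod_cast n.succ_ne_zero
  have h := X_mul_laguerrePoly (g - 1 / 2) n
  refine Polynomial.funext fun y => ?_
  have h := congrArg (eval y) h
  have hP : laguerre.P (g + laguerre.δ) n = laguerrePoly (g - 1 / 2 + 1) n := by
    simp only [laguerre]; congr 1; push_cast; ring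
  rw [hP, Fin.sum_univ_two, laguerre_Phi]
  simp only [laguerre, laguerreAlpha, laguerreBeta, Finset.univ_unique, Finset.prod_singleton]
  simp at h ⊢
  rw [h]
  field_simp
  ring

theorem laguerre_entry (g : ℝ) (n : ℕ) (j : Fin 1) :
    laguerre.entry g n j = poch (g + 1 / 2) n / n.factorial := by
  rw [OQM.entry_eq_eval (Function.injective_of_subsingleton _), Subsingleton.elim j 0]
  simp only [laguerre, Matrix.cons_val_zero]
  rw [← coeff_zero_eq_eval_zero, coeff_laguerrePoly]
  simp only [poch_zero, Nat.sub_zero, Nat.factorial_zero, Nat.cast_zero, Nat.cast_one]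
  rw [show (g : ℂ) - 1 / 2 + 1 + 0 = g + 1 / 2 by ring]
  ring

theorem laguerre_c (g : ℝ) (n : ℕ) : laguerre.c g n = (-1) ^ n / n.factorial := by
  have hn : ((n.factorial : ℕ) : ℂ) ≠ 0 := by exact_mod_cast n.factorial_ne_zero
  simp only [OQM.c, laguerre, coeff_laguerrePoly, poch_neg_natCast_self, Nat.sub_self, poch_zero]
  field_simp

/-! ### Jacobi -/

theorem jacobi_Phi : jacobi.Phi = C (-1 / 4) * ∏ j, (X - C (jacobi.zero j)) := by
  refine Polynomial.funext fun y => ?_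
  simp only [OQM.Phi, jacobi, Fin.prod_univ_two, Matrix.cons_val, eval_mul, eval_C, eval_sub,
    eval_one, eval_pow, eval_X]
  ring

theorem jacobi_zero_injective : Function.Injective jacobi.zero := by
  intro i j h
  fin_cases i <;> fin_cases j <;>
    first | rfl | (simp [jacobi] at h; norm_num [Complex.ext_iff] at h)

theorem jacobi_relation (g h : ℝ) (n : ℕ) (h1 : 2 * n + g + h + 1 ≠ 0)
    (h2 : 2 * n + g + h + 2 ≠ 0) (h3 : 2 * n + g + h + 3 ≠ 0) :
    jacobi.Phi * jacobi.P ((g, h) + jacobi.δ) n =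
      C (jacobiBeta g h n : ℂ) *
        ∑ k : Fin 3, C (jacobiAlpha g h n k : ℂ) * jacobi.P (g, h) (n + k) := by
  have hn1 : (n + 1 : ℂ) ≠ 0 := by exact_mod_cast n.succ_ne_zero
  have hn2 : (n + 2 : ℂ) ≠ 0 := by exact_mod_cast (n + 1).succ_ne_zero
  have h1 : (2 * n + g + h + 1 : ℂ) ≠ 0 := by exact_mod_cast h1
  have h2 : (2 * n + g + h + 2 : ℂ) ≠ 0 := by exact_mod_cast h2
  have h3 : (2 * n + g + h + 3 : ℂ) ≠ 0 := by exact_mod_cast h3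
  refine Polynomial.funext fun y => ?_
  have hr := congrArg (eval y) (one_sub_X_sq_mul_jacobiPoly (g - 1 / 2) (h - 1 / 2) n)
  have hP : jacobi.P ((g, h) + jacobi.δ) n =
      jacobiPoly (g - 1 / 2 + 1) (h - 1 / 2 + 1) n := by
    simp only [jacobi, Prod.mk_add_mk]; congr 1 <;> push_cast <;> ring
  have hΦ : jacobi.Phi.eval y = 1 / 4 * (1 - y ^ 2) := by
    simp only [OQM.Phi, jacobi, eval_mul, eval_C, eval_sub, eval_one, eval_pow, eval_X]
    norm_num
  rw [hP, Fin.sum_univ_three, eval_mul, hΦ]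
  simp only [jacobi, jacobiAlpha, jacobiBeta, Matrix.cons_val, Fin.val_zero, Fin.val_one,
    Fin.val_two, add_zero, eval_mul, eval_C, eval_add, eval_sub, eval_one, eval_pow,
    eval_X] at hr ⊢
  generalize (jacobiPoly (g - 1 / 2 + 1) (h - 1 / 2 + 1) n).eval y = q at *
  generalize (jacobiPoly (g - 1 / 2) (h - 1 / 2) n).eval y = p0 at *
  generalize (jacobiPoly (g - 1 / 2) (h - 1 / 2) (n + 1)).eval y = p1 at *
  generalize (jacobiPoly (g - 1 / 2) (h - 1 / 2) (n + 2)).eval y = p2 at *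
  apply mul_left_cancel₀ (mul_ne_zero (mul_ne_zero h1 h2) h3)
  have hr' : (2 * n + g + h + 1) * (2 * n + g + h + 2) * (2 * n + g + h + 3) *
      (1 / 4 * (1 - y ^ 2) * q) = (n + g + 1 / 2) * (n + h + 1 / 2) * (2 * n + g + h + 3) * p0 +
      (n + 1) * (g - h) * (2 * n + g + h + 2) * p1 -
      (n + 1) * (n + 2) * (2 * n + g + h + 1) * p2 := by
    linear_combination hr
  rw [hr']
  push_cast
  -- The remaining identity is formal in these three denominators, so their mutual relations can be
  -- forgotten.
  generalize (2 * n + g + h + 1 : ℂ) = a at *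
  generalize (2 * n + g + h + 2 : ℂ) = b at *
  generalize (2 * n + g + h + 3 : ℂ) = c at *
  field_simp
  ring

theorem jacobi_entry_zero (l : ℝ × ℝ) (n : ℕ) : jacobi.entry l n 0 =
    (jacobiPoly (l.1 - 1 / 2) (l.2 - 1 / 2) n).eval 1 := by
  rw [OQM.entry_eq_eval jacobi_zero_injective]; simp [jacobi]

theorem jacobi_entry_one (l : ℝ × ℝ) (n : ℕ) : jacobi.entry l n 1 =
    (jacobiPoly (l.1 - 1 / 2) (l.2 - 1 / 2) n).eval (-1) := by
  rw [OQM.entry_eq_eval jacobi_zero_injective]; simp [jacobi]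

theorem jacobi_entry_ne_zero {g h : ℝ} {n : ℕ} (hg : ∀ j : ℕ, j < n → g + 1 / 2 + j ≠ 0)
    (hh : ∀ j : ℕ, j < n → h + 1 / 2 + j ≠ 0) (j : Fin 2) : jacobi.entry (g, h) n j ≠ 0 := by
  have hn : ((n.factorial : ℕ) : ℂ) ≠ 0 := by exact_mod_cast n.factorial_ne_zero
  fin_cases j
  · simp only [Fin.zero_eta, jacobi_entry_zero, eval_one_jacobiPoly]
    refine div_ne_zero (poch_ne_zero fun j hj h0 => hg j hj ?_) hn
    have : ((g + 1 / 2 + j : ℝ) : ℂ) = 0 := by push_cast; linear_combination h0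
    exact_mod_cast this
  · simp only [Fin.mk_one, jacobi_entry_one, eval_neg_one_jacobiPoly]
    refine div_ne_zero (mul_ne_zero (by simp) (poch_ne_zero fun j hj h0 => hh j hj ?_)) hn
    have : ((h + 1 / 2 + j : ℝ) : ℂ) = 0 := by push_cast; linear_combination h0
    exact_mod_cast this

theorem jacobi_rawDet_ne_zero {g h : ℝ} {n : ℕ} (he : ∀ j, jacobi.entry (g, h) n j ≠ 0)
    (h1 : 2 * n + g + h + 1 ≠ 0) : jacobi.rawDet (g, h) n (OQM.base 2) ≠ 0 := by
  have h1 : (2 * n + g + h + 1 : ℂ) ≠ 0 := by exact_mod_cast h1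
  have e0 := he 0
  have e1 := he 1
  rw [OQM.rawDet_two]
  simp only [OQM.base, Fin.val_zero, Fin.val_one, add_zero, jacobi_entry_zero,
    jacobi_entry_one] at *
  have hd := eval_one_mul_eval_neg_one_jacobiPoly (g - 1 / 2) (h - 1 / 2) n
  intro h0
  have h2 : (2 * n + g + h + 1 : ℂ) * (eval 1 (jacobiPoly (g - 1 / 2) (h - 1 / 2) n) *
      eval (-1) (jacobiPoly (g - 1 / 2) (h - 1 / 2) n)) = 0 := by
    linear_combination -hd - (n + 1) * h0
  exact mul_ne_zero h1 (mul_ne_zero e0 e1) h2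

theorem jacobi_c (g h : ℝ) (n : ℕ) :
    jacobi.c (g, h) n = poch (n + g + h) n / (2 ^ n * n.factorial) := by
  simp only [OQM.c, jacobi, coeff_jacobiPoly_self]
  congr 2; ring

/-! ### Bessel -/

theorem bessel_Phi : bessel.Phi = C 1 * ∏ j, (X - C (bessel.zero j)) := by
  refine Polynomial.funext fun y => ?_
  simp [OQM.Phi, bessel, Fin.prod_univ_two]
  ring

theorem bessel_relation (h : ℝ) (n : ℕ) (h1 : 2 * n - 2 * h + 1 ≠ 0)
    (h2 : 2 * n - 2 * h + 2 ≠ 0) (h3 : 2 * n - 2 * h + 3 ≠ 0) :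
    bessel.Phi * bessel.P (h + bessel.δ) n =
      C (besselBeta h n : ℂ) *
        ∑ k : Fin 3, C (besselAlpha h n k : ℂ) * bessel.P h (n + k) := by
  have h1 : (2 * n - 2 * h + 1 : ℂ) ≠ 0 := by exact_mod_cast h1
  have h2 : (2 * n - 2 * h + 2 : ℂ) ≠ 0 := by exact_mod_cast h2
  have h3 : (2 * n - 2 * h + 3 : ℂ) ≠ 0 := by exact_mod_cast h3
  have h1' : (2 * (n - h) + 1 : ℂ) ≠ 0 := by convert h1 using 1; ring
  have h2' : (n - h + 1 : ℂ) ≠ 0 := fun h0 => h2 (by linear_combination 2 * h0)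
  have h3' : (2 * (n - h) + 3 : ℂ) ≠ 0 := by convert h3 using 1; ring
  refine Polynomial.funext fun y => ?_
  have hr := congrArg (eval y) (X_sq_mul_besselPoly (-2 * h - 1) n)
  have hP : bessel.P (h + bessel.δ) n = besselPoly (-2 * h - 1 + 2) n := by
    simp only [bessel]; congr 1; push_cast; ring
  have hΦ : bessel.Phi.eval y = y ^ 2 := by simp [OQM.Phi, bessel]
  rw [hP, Fin.sum_univ_three, eval_mul, hΦ]
  simp only [bessel, besselAlpha, besselBeta, Matrix.cons_val, Fin.val_zero, Fin.val_one,
    Fin.val_two, add_zero, eval_mul, eval_C, eval_add, eval_sub, eval_pow, eval_X] at hr ⊢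
  generalize (besselPoly (-2 * h - 1 + 2) n).eval y = q at *
  generalize (besselPoly (-2 * h - 1) n).eval y = p0 at *
  generalize (besselPoly (-2 * h - 1) (n + 1)).eval y = p1 at *
  generalize (besselPoly (-2 * h - 1) (n + 2)).eval y = p2 at *
  apply mul_left_cancel₀ (mul_ne_zero (mul_ne_zero h1 h2) h3)
  have hr' : (2 * n - 2 * h + 1) * (2 * n - 2 * h + 2) * (2 * n - 2 * h + 3) * (y ^ 2 * q) =
      4 * (2 * n - 2 * h + 1) * p2 - 8 * (2 * n - 2 * h + 2) * p1 +
      4 * (2 * n - 2 * h + 3) * p0 := by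
    linear_combination hr
  rw [hr']
  push_cast
  field_simp
  ring

theorem bessel_entry_zero (h : ℝ) (n : ℕ) : bessel.entry h n 0 = 1 := by
  have ho : bessel.order 0 = 0 := by simp [OQM.order]
  rw [OQM.entry, ho]
  simp only [bessel, Function.iterate_zero, id, Matrix.cons_val_zero]
  rw [← coeff_zero_eq_eval_zero, coeff_besselPoly]
  simp [poch_zero]

theorem bessel_entry_one (h : ℝ) (n : ℕ) : bessel.entry h n 1 = n * (n - 2 * h) / 2 := by
  have ho : bessel.order 1 = 1 := by
    rw [OQM.order, Finset.card_eq_one]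
    refine ⟨0, ?_⟩
    ext i
    fin_cases i <;> simp [bessel]
  rw [OQM.entry, ho]
  simp only [bessel, Function.iterate_one, Matrix.cons_val]
  rw [← coeff_zero_eq_eval_zero, coeff_derivative,
    coeff_besselPoly]
  simp [poch_succ, poch_zero]
  ring

theorem bessel_rawDet (h : ℝ) (n : ℕ) :
    bessel.rawDet h n (OQM.base 2) = (2 * n - 2 * h + 1) / 2 := by
  rw [OQM.rawDet_two]
  simp only [OQM.base, Fin.val_zero, Fin.val_one, bessel_entry_zero, bessel_entry_one]
  push_cast; ring

/-- The double zero rules out `OQM.sum_mul_entry_eq_zero`; instead the explicit values 1 and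
n(n-2h)/2 of P_n and P_n' at 0 are inserted. -/
theorem bessel_sum_mul_entry (h : ℝ) (n : ℕ) (h1 : 2 * n - 2 * h + 1 ≠ 0) (j : Fin 2) :
    ∑ k : Fin 3, (besselAlpha h n k : ℂ) * bessel.entry h (n + k) j = 0 := by
  have h1 : (2 * n - 2 * h + 1 : ℂ) ≠ 0 := by exact_mod_cast h1
  have h1' : (2 * (n - h) + 1 : ℂ) ≠ 0 := by convert h1 using 1; ring
  simp only [Fin.sum_univ_three, besselAlpha, Matrix.cons_val, Fin.val_zero, Fin.val_one,
    Fin.val_two, add_zero]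
  fin_cases j
  · simp only [Fin.zero_eta, bessel_entry_zero]
    push_cast; field_simp; ring
  · simp only [Fin.mk_one, bessel_entry_one]
    push_cast; field_simp; ring

theorem bessel_c (h : ℝ) (n : ℕ) : bessel.c h n = poch (n - 2 * h) n / 2 ^ n := by
  have hn : ((n.factorial : ℕ) : ℂ) ≠ 0 := by exact_mod_cast n.factorial_ne_zero
  simp only [OQM.c, bessel, coeff_besselPoly, poch_neg_natCast_self]
  rw [show (n : ℂ) + (-2 * h - 1) + 1 = n - 2 * h by ring, div_pow]
  have h2 : ((-1 : ℂ) ^ n) * (-1) ^ n = 1 := by rw [← mul_pow]; simp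
  field_simp
  linear_combination poch (n - 2 * h) n * h2

/-! ### Pseudo Jacobi -/

theorem pseudoJacobi_Phi :
    pseudoJacobi.Phi = C 1 * ∏ j, (X - C (pseudoJacobi.zero j)) := by
  refine Polynomial.funext fun y => ?_
  simp only [OQM.Phi, pseudoJacobi, Fin.prod_univ_two, Matrix.cons_val, eval_mul, eval_C,
    eval_sub, eval_add, eval_one, eval_pow, eval_X]
  linear_combination Complex.I_sq

theorem pseudoJacobi_zero_injective : Function.Injective pseudoJacobi.zero := by
  intro i j h
  fin_cases i <;> fin_cases j <;>
    first | rfl | (simp [pseudoJacobi] at h; norm_num [Complex.ext_iff] at h)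

/-- The normalization constant of the pseudo Jacobi polynomials. -/
noncomputable def pseudoJacobiConst (h : ℂ) (n : ℕ) : ℂ :=
  (-2 * Complex.I) ^ n * n.factorial / poch (n - 2 * h) n

theorem pseudoJacobi_P (l : ℝ × ℝ) (n : ℕ) : pseudoJacobi.P l n =
    C (pseudoJacobiConst l.1 n) * (jacobiPoly (-l.1 - 1 / 2 - Complex.I * l.2)
      (-l.1 - 1 / 2 + Complex.I * l.2) n).comp (C Complex.I * X) := by
  simp only [pseudoJacobi, pseudoJacobiPoly, pseudoJacobiConst]
  congr 3
  · congr 1; ring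
  · ring
  · ring

theorem pseudoJacobiConst_ne_zero {h : ℂ} {n : ℕ} (hp : poch (n - 2 * h) n ≠ 0) :
    pseudoJacobiConst h n ≠ 0 := by
  have hn : ((n.factorial : ℕ) : ℂ) ≠ 0 := by exact_mod_cast n.factorial_ne_zero
  exact div_ne_zero (mul_ne_zero (by simp) hn) hp

/-- The normalization makes the polynomial monic: (-2i)^n from the constant and i^n from the
substitution cancel the 2^n in the Jacobi leading coefficient. -/
theorem pseudoJacobi_c {l : ℝ × ℝ} {n : ℕ} (hp : poch (n - 2 * l.1) n ≠ 0) :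
    pseudoJacobi.c l n = 1 := by
  have hn : ((n.factorial : ℕ) : ℂ) ≠ 0 := by exact_mod_cast n.factorial_ne_zero
  have h3 : (2 : ℂ) ^ n ≠ 0 := pow_ne_zero n two_ne_zero
  rw [OQM.c, pseudoJacobi_P, coeff_C_mul,
    coeff_comp_of_natDegree_le (jacobiPoly_natDegree_le _ _ n) (by compute_degree),
    coeff_jacobiPoly_self, coeff_C_mul, coeff_X_one, pseudoJacobiConst]
  rw [show (n : ℂ) + (-l.1 - 1 / 2 - Complex.I * l.2) + (-l.1 - 1 / 2 + Complex.I * l.2) + 1 =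
    n - 2 * l.1 by ring]
  have hI : (-2 * Complex.I) ^ n * Complex.I ^ n = 2 ^ n := by
    rw [← mul_pow]; congr 1; linear_combination -2 * Complex.I_sq
  field_simp
  linear_combination hI

theorem poch_step (s : ℂ) (n : ℕ) :
    poch (n + 2 - s) (n + 2) = poch (n + 2 - s) n * ((2 * n + 2 - s) * (2 * n + 3 - s)) := by
  rw [poch_succ, poch_succ]; push_cast; ring

theorem poch_step_left (s : ℂ) (n : ℕ) :
    poch (n + 1 - s) (n + 1) = (n + 1 - s) * poch (n + 2 - s) n := by
  rw [poch_succ_left]; congr 2; ring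

/-- Both sides are (n-s)_{n+2}, with two factors split off at the end or at the beginning. -/
theorem poch_mul_step (s : ℂ) (n : ℕ) :
    poch (n - s) n * ((2 * n - s) * (2 * n + 1 - s)) =
      (n - s) * (n + 1 - s) * poch (n + 2 - s) n := by
  have h1 : poch (n - s) (n + 2) = poch (n - s) n * ((2 * n - s) * (2 * n + 1 - s)) := by
    rw [poch_succ, poch_succ]; push_cast; ring
  rw [← h1, poch_succ_left, poch_succ_left, mul_assoc]
  congr 4 <;> ring

/-- The coefficients `α_{n,k}` for pseudo Jacobi in a form without the restriction `h ≠ n`. -/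
noncomputable def pseudoJacobiCoeff (h μ : ℂ) (n : ℕ) : Fin 3 → ℂ :=
  ![((2 * n + 1 - 2 * h) ^ 2 + 4 * μ ^ 2) * poch (n - 2 * h) n /
      (poch (n + 2 - 2 * h) n * ((2 * n + 1 - 2 * h) * (2 * n + 2 - 2 * h))),
    4 * μ * (n + 1 - 2 * h) / ((2 * n + 1 - 2 * h) * (2 * n + 3 - 2 * h)),
    1]

theorem pseudoJacobi_relation {h : ℝ} (μ : ℝ) {n : ℕ} (h0 : poch (n - 2 * h) n ≠ 0)
    (h1 : poch (n + 1 - 2 * h) (n + 1) ≠ 0) (h2 : poch (n + 2 - 2 * h) (n + 2) ≠ 0)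
    (h3 : (2 * n + 1 - 2 * h : ℂ) ≠ 0) :
    pseudoJacobi.Phi * pseudoJacobi.P ((h, μ) + pseudoJacobi.δ) n =
      C 1 * ∑ k : Fin 3, C (pseudoJacobiCoeff h μ n k) * pseudoJacobi.P (h, μ) (n + k) := by
  rw [poch_step] at h2
  rw [poch_step_left] at h1
  have hQ := left_ne_zero_of_mul h2
  have h4 := left_ne_zero_of_mul (right_ne_zero_of_mul h2)
  have h5 := right_ne_zero_of_mul (right_ne_zero_of_mul h2)
  have h6 := left_ne_zero_of_mul h1
  refine Polynomial.funext fun y => ?_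
  have hr := congrArg (eval (Complex.I * y)) (one_sub_X_sq_mul_jacobiPoly
    (-h - 1 / 2 - Complex.I * μ) (-h - 1 / 2 + Complex.I * μ) n)
  have hΦ : pseudoJacobi.Phi.eval y = 1 + y ^ 2 := by
    simp [OQM.Phi, pseudoJacobi]
  have hs : ((h, μ) + pseudoJacobi.δ : ℝ × ℝ) = (h - 1, μ) := by
    simp [pseudoJacobi, sub_eq_add_neg]
  -- w is the common numerator of the four normalization constants. Three of their denominators are
  -- multiples of (n+2-2h)_n; only that of P_n(λ) involves (n-2h)_n.
  obtain ⟨w, hw⟩ : ∃ w : ℂ, w = (-2 * Complex.I) ^ n * n.factorial := ⟨_, rfl⟩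
  have hc : pseudoJacobiConst (h - 1) n = w / poch (n + 2 - 2 * h) n := by
    rw [pseudoJacobiConst, hw]; congr 2; ring
  have hc0 : pseudoJacobiConst h n = w / poch (n - 2 * h) n := by
    rw [pseudoJacobiConst, hw]
  have hc1 : pseudoJacobiConst h (n + 1) =
      w * (-2 * Complex.I * (n + 1)) / ((n + 1 - 2 * h) * poch (n + 2 - 2 * h) n) := by
    rw [pseudoJacobiConst, pow_succ, Nat.factorial_succ, ← poch_step_left, hw]
    push_cast
    congr 1
    ring
  have hc2 : pseudoJacobiConst h (n + 2) = w * (-4 * (n + 2) * (n + 1)) /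
        (poch (n + 2 - 2 * h) n * ((2 * n + 2 - 2 * h) * (2 * n + 3 - 2 * h))) := by
    rw [pseudoJacobiConst, pow_succ, pow_succ, Nat.factorial_succ, Nat.factorial_succ,
      ← poch_step, hw]
    push_cast
    congr 1
    linear_combination 4 * (-2 * Complex.I) ^ n * (n + 2) * (n + 1) * n.factorial * Complex.I_sq
  rw [hs, Fin.sum_univ_three, eval_mul, hΦ]
  simp only [pseudoJacobi_P, pseudoJacobiCoeff, Matrix.cons_val, Fin.val_zero, Fin.val_one,
    Fin.val_two, add_zero, eval_mul, eval_C, eval_add, eval_sub, eval_one, eval_pow, eval_X,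
    eval_comp] at hr ⊢
  rw [show -((h - 1 : ℝ) : ℂ) - 1 / 2 - Complex.I * μ = -h - 1 / 2 - Complex.I * μ + 1 by
      push_cast; ring,
    show -((h - 1 : ℝ) : ℂ) - 1 / 2 + Complex.I * μ = -h - 1 / 2 + Complex.I * μ + 1 by
      push_cast; ring, Complex.ofReal_sub, Complex.ofReal_one, hc, hc0, hc1, hc2]
  generalize (jacobiPoly (-h - 1 / 2 - Complex.I * μ + 1)
    (-h - 1 / 2 + Complex.I * μ + 1) n).eval (Complex.I * y) = q at *
  generalize (jacobiPoly (-h - 1 / 2 - Complex.I * μ)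
    (-h - 1 / 2 + Complex.I * μ) n).eval (Complex.I * y) = p0 at *
  generalize (jacobiPoly (-h - 1 / 2 - Complex.I * μ)
    (-h - 1 / 2 + Complex.I * μ) (n + 1)).eval (Complex.I * y) = p1 at *
  generalize (jacobiPoly (-h - 1 / 2 - Complex.I * μ)
    (-h - 1 / 2 + Complex.I * μ) (n + 2)).eval (Complex.I * y) = p2 at *
  generalize poch (n + 2 - 2 * h) n = Q at *
  generalize poch (n - 2 * h) n = Q0 at *
  -- The parameters are conjugate: 4(n+α+1)(n+β+1) = (2n+1-2h)² + 4μ² and α - β = -2iμ, while 1 -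
  -- (iy)² = 1 + y².
  have hr' : (2 * n + 1 - 2 * h) * (2 * n + 2 - 2 * h) * (2 * n + 3 - 2 * h) *
      ((1 + y ^ 2) * q) =
      ((2 * n + 1 - 2 * h) ^ 2 + 4 * μ ^ 2) * (2 * n + 3 - 2 * h) * p0 -
      8 * (n + 1) * Complex.I * μ * (2 * n + 2 - 2 * h) * p1 -
      4 * (n + 1) * (n + 2) * (2 * n + 1 - 2 * h) * p2 := by
    linear_combination 4 * hr + ((2 * n + 1 - 2 * h) * (2 * n + 2 - 2 * h) *
      (2 * n + 3 - 2 * h) * q * y ^ 2 - 4 * μ ^ 2 * (2 * n + 3 - 2 * h) * p0) * Complex.I_sq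
  have hq : (1 + y ^ 2) * q = (((2 * n + 1 - 2 * h) ^ 2 + 4 * μ ^ 2) * (2 * n + 3 - 2 * h) * p0 -
      8 * (n + 1) * Complex.I * μ * (2 * n + 2 - 2 * h) * p1 -
      4 * (n + 1) * (n + 2) * (2 * n + 1 - 2 * h) * p2) /
      ((2 * n + 1 - 2 * h) * (2 * n + 2 - 2 * h) * (2 * n + 3 - 2 * h)) := by
    rw [eq_div_iff (mul_ne_zero (mul_ne_zero h3 h4) h5), ← hr']; ring
  rw [mul_left_comm, hq]
  generalize (2 * n + 1 - 2 * h : ℂ) = a at *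
  generalize (2 * n + 2 - 2 * h : ℂ) = b at *
  generalize (2 * n + 3 - 2 * h : ℂ) = c at *
  generalize (n + 1 - 2 * h : ℂ) = d at *
  field_simp
  ring

/-- The substitution iη sends the zeros i and -i of Φ to -1 and 1, in this order. -/
theorem pseudoJacobi_entry_zero (h μ : ℝ) (n : ℕ) : pseudoJacobi.entry (h, μ) n 0 =
    pseudoJacobiConst h n * (jacobiPoly (-h - 1 / 2 - Complex.I * μ)
      (-h - 1 / 2 + Complex.I * μ) n).eval (-1) := by
  rw [OQM.entry_eq_eval pseudoJacobi_zero_injective, pseudoJacobi_P]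
  simp [pseudoJacobi]

theorem pseudoJacobi_entry_one (h μ : ℝ) (n : ℕ) : pseudoJacobi.entry (h, μ) n 1 =
    pseudoJacobiConst h n * (jacobiPoly (-h - 1 / 2 - Complex.I * μ)
      (-h - 1 / 2 + Complex.I * μ) n).eval 1 := by
  rw [OQM.entry_eq_eval pseudoJacobi_zero_injective, pseudoJacobi_P]
  simp [pseudoJacobi]

theorem pseudoJacobi_entry_ne_zero {h μ : ℝ} {n : ℕ} (h0 : poch (n - 2 * h) n ≠ 0)
    (hμ : ∀ j : ℕ, j < n → ¬ (μ = 0 ∧ h = 1 / 2 + j)) (j : Fin 2) :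
    pseudoJacobi.entry (h, μ) n j ≠ 0 := by
  have hn : ((n.factorial : ℕ) : ℂ) ≠ 0 := by exact_mod_cast n.factorial_ne_zero
  fin_cases j
  · simp only [Fin.zero_eta, pseudoJacobi_entry_zero, eval_neg_one_jacobiPoly]
    refine mul_ne_zero (pseudoJacobiConst_ne_zero h0) (div_ne_zero (mul_ne_zero (by simp)
      (poch_ne_zero fun j hj hz => hμ j hj ?_)) hn)
    -- A factor 1/2 - h ± iμ + j with h and μ real vanishes only if both its real and imaginary
    -- parts do.
    have hre := congrArg Complex.re hz
    have him := congrArg Complex.im hz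
    simp at hre him
    exact ⟨him, by linarith⟩
  · simp only [Fin.mk_one, pseudoJacobi_entry_one, eval_one_jacobiPoly]
    refine mul_ne_zero (pseudoJacobiConst_ne_zero h0) (div_ne_zero
      (poch_ne_zero fun j hj hz => hμ j hj ?_) hn)
    have hre := congrArg Complex.re hz
    have him := congrArg Complex.im hz
    simp at hre him
    exact ⟨him, by linarith⟩

theorem pseudoJacobi_rawDet_ne_zero {h μ : ℝ} {n : ℕ} (h0 : poch (n - 2 * h) n ≠ 0)
    (h1 : poch (n + 1 - 2 * h) (n + 1) ≠ 0) (h3 : (2 * n + 1 - 2 * h : ℂ) ≠ 0)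
    (he : ∀ j, pseudoJacobi.entry (h, μ) n j ≠ 0) :
    pseudoJacobi.rawDet (h, μ) n (OQM.base 2) ≠ 0 := by
  have e0 := he 0
  have e1 := he 1
  have c0 := pseudoJacobiConst_ne_zero h0
  have c1 : pseudoJacobiConst h (n + 1) ≠ 0 :=
    pseudoJacobiConst_ne_zero (by push_cast; exact h1)
  rw [OQM.rawDet_two]
  simp only [OQM.base, Fin.val_zero, Fin.val_one, add_zero, pseudoJacobi_entry_zero,
    pseudoJacobi_entry_one] at *
  have hd := eval_one_mul_eval_neg_one_jacobiPoly (-h - 1 / 2 - Complex.I * μ)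
    (-h - 1 / 2 + Complex.I * μ) n
  have e0 := right_ne_zero_of_mul e0
  have e1 := right_ne_zero_of_mul e1
  generalize jacobiPoly (-h - 1 / 2 - Complex.I * μ) (-h - 1 / 2 + Complex.I * μ) n = p at *
  generalize jacobiPoly (-h - 1 / 2 - Complex.I * μ)
    (-h - 1 / 2 + Complex.I * μ) (n + 1) = q at *
  intro hz
  have hp : pseudoJacobiConst h n * pseudoJacobiConst h (n + 1) *
      ((2 * n + 1 - 2 * h) * (eval 1 p * eval (-1) p)) = 0 := by
    linear_combination (n + 1) * hz - pseudoJacobiConst h n * pseudoJacobiConst h (n + 1) * hd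
  exact mul_ne_zero (mul_ne_zero c0 c1) (mul_ne_zero h3 (mul_ne_zero e1 e0)) hp

/-- The closed form divides by h - n, a factor that `poch_mul_step` introduces when (n-2h)_n is
compared with (n+2-2h)_n. When all polynomials involved are defined, h = n happens only for n = h =
0. -/
theorem pseudoJacobiCoeff_eq {h : ℝ} (μ : ℝ) {n : ℕ}
    (h2 : poch (n + 2 - 2 * h) (n + 2) ≠ 0) (h3 : (2 * n + 1 - 2 * h : ℂ) ≠ 0) (hn : h ≠ n)
    (k : Fin 3) : pseudoJacobiCoeff h μ n k = (pseudoJacobiAlpha h μ n k : ℂ) := by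
  rw [poch_step] at h2
  have hQ := left_ne_zero_of_mul h2
  have h4 := left_ne_zero_of_mul (right_ne_zero_of_mul h2)
  have h5 := right_ne_zero_of_mul (right_ne_zero_of_mul h2)
  have h6 : (2 * n - 2 * h : ℂ) ≠ 0 := by
    have : (n - h : ℂ) ≠ 0 := sub_ne_zero.mpr (by exact_mod_cast hn.symm)
    intro hz
    exact this (by linear_combination hz / 2)
  have hs := poch_mul_step (2 * h) n
  fin_cases k
  · simp only [Fin.zero_eta, pseudoJacobiCoeff, pseudoJacobiAlpha, Matrix.cons_val]
    push_cast
    rw [show (2 * h - n - 1 : ℂ) * (2 * h - n) * ((2 * h - 2 * n - 1) ^ 2 + 4 * μ ^ 2) =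
        (n - 2 * h) * (n + 1 - 2 * h) * ((2 * n + 1 - 2 * h) ^ 2 + 4 * μ ^ 2) by ring,
      show 4 * ((h - n - 1) * (h - n)) * (2 * h - 2 * n - 1) ^ 2 =
        (2 * n - 2 * h : ℂ) * (2 * n + 2 - 2 * h) * (2 * n + 1 - 2 * h) ^ 2 by ring]
    rw [div_eq_div_iff (mul_ne_zero hQ (mul_ne_zero h3 h4))
      (mul_ne_zero (mul_ne_zero h6 h4) (pow_ne_zero 2 h3))]
    linear_combination ((2 * n + 1 - 2 * h) ^ 2 + 4 * μ ^ 2 : ℂ) * (2 * n + 2 - 2 * h) *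
      (2 * n + 1 - 2 * h) * hs
  · simp only [Fin.mk_one, pseudoJacobiCoeff, pseudoJacobiAlpha, Matrix.cons_val]
    push_cast
    rw [show (2 * h - 2 * n - 1 : ℂ) * (2 * h - 2 * n - 3) =
      (2 * n + 1 - 2 * h) * (2 * n + 3 - 2 * h) by ring, ← neg_div]
    congr 1
    ring
  · simp [pseudoJacobiCoeff, pseudoJacobiAlpha]

/-! ### Nonvanishing conditions and the constants β_n -/

theorem poch_sub_two_mul_ne_zero {h : ℝ} {n i : ℕ}
    (hh : ∀ i j : ℕ, i ≤ 2 → j < n + i → 2 * h ≠ n + i + j) (hi : i ≤ 2) :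
    poch ((n + i : ℕ) - 2 * h) (n + i) ≠ 0 := by
  refine poch_ne_zero fun j hj hz => hh i j hi hj ?_
  have : ((2 * h : ℝ) : ℂ) = ((n + i + j : ℝ) : ℂ) := by
    push_cast at hz ⊢; linear_combination -hz
  exact_mod_cast this

theorem poch_ne_zero_of_real {a : ℝ} {k : ℕ} (h : ∀ j : ℕ, j < k → a + j ≠ 0) :
    poch (a : ℂ) k ≠ 0 :=
  poch_ne_zero fun j hj => by exact_mod_cast h j hj

/-- In c_n(λ+δ) / c_{n+2}(λ) the parameter shift compensates the index shift, so both Pochhammer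
symbols start at the same point and only two factors survive. -/
theorem poch_div_poch_add_two {a b : ℂ} {n : ℕ} (hb : b = a) (h : poch a (n + 2) ≠ 0) :
    poch b n / poch a (n + 2) = 1 / ((a + n) * (a + n + 1)) := by
  rw [poch_succ, poch_succ] at *
  have h1 := left_ne_zero_of_mul (left_ne_zero_of_mul h)
  have h2 := right_ne_zero_of_mul (left_ne_zero_of_mul h)
  have h3 := right_ne_zero_of_mul h
  rw [hb, div_eq_div_iff h (mul_ne_zero h2 (by convert h3 using 1; push_cast; ring))]
  push_cast; ring

theorem pseudoJacobi_defined {h : ℝ} {n : ℕ}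
    (hh : ∀ i j : ℕ, i ≤ 2 → j < n + i → 2 * h ≠ n + i + j) :
    poch (n - 2 * h) n ≠ 0 ∧ poch (n + 1 - 2 * h) (n + 1) ≠ 0 ∧
      poch (n + 2 - 2 * h) (n + 2) ≠ 0 ∧ (2 * n + 1 - 2 * h : ℂ) ≠ 0 := by
  have h0 := poch_sub_two_mul_ne_zero hh (i := 0) (by omega)
  have h1 := poch_sub_two_mul_ne_zero hh (i := 1) (by omega)
  have h2 := poch_sub_two_mul_ne_zero hh (i := 2) (by omega)
  push_cast at h0 h1 h2
  rw [add_zero] at h0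
  refine ⟨h0, h1, h2, fun hz => ?_⟩
  -- 2n+1-2h is the last factor of (n+1-2h)_{n+1}, so the condition for a nonzero determinant is
  -- automatic here.
  rw [poch_succ] at h1
  exact right_ne_zero_of_mul h1 (by linear_combination hz)

theorem laguerre_beta (g : ℝ) (n : ℕ) : laguerre.beta g n = (laguerreBeta n : ℂ) := by
  have hn : ((n.factorial : ℕ) : ℂ) ≠ 0 := by exact_mod_cast n.factorial_ne_zero
  have hn1 : (n + 1 : ℂ) ≠ 0 := by exact_mod_cast n.succ_ne_zero
  rw [OQM.beta, OQM.cPhi_eq laguerre_Phi, laguerre_c, laguerre_c, pow_succ, Nat.factorial_succ,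
    laguerreBeta]
  push_cast
  field_simp

theorem jacobi_beta {g h : ℝ} {n : ℕ} (hp : poch (n + 2 + g + h) (n + 2) ≠ 0) :
    jacobi.beta (g, h) n = (jacobiBeta g h n : ℂ) := by
  have hn : ((n.factorial : ℕ) : ℂ) ≠ 0 := by exact_mod_cast n.factorial_ne_zero
  have hn1 : (n + 1 : ℂ) ≠ 0 := by exact_mod_cast n.succ_ne_zero
  have hn2 : (n + 2 : ℂ) ≠ 0 := by exact_mod_cast (n + 1).succ_ne_zero
  have h2 : (2 : ℂ) ^ n ≠ 0 := pow_ne_zero n two_ne_zero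
  rw [OQM.beta, OQM.cPhi_eq jacobi_Phi,
    show (g, h) + jacobi.δ = (g + 1, h + 1) from rfl, jacobi_c, jacobi_c]
  have hd := poch_div_poch_add_two (b := n + (g + 1 : ℝ) + (h + 1 : ℝ))
    (by push_cast; ring) hp
  push_cast at hd ⊢
  rw [div_eq_iff hp] at hd
  rw [hd, Nat.factorial_succ, Nat.factorial_succ, jacobiBeta, pow_add]
  push_cast
  rw [show (n + 2 + g + h + n : ℂ) = 2 * n + g + h + 2 by ring,
    show (2 * n + g + h + 2 + 1 : ℂ) = 2 * n + g + h + 3 by ring,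
    show (n + 1 + 1 : ℂ) = n + 2 by ring]
  generalize poch (n + 2 + g + h) (n + 2) = Q at *
  generalize (2 * n + g + h + 2 : ℂ) = b at *
  generalize (2 * n + g + h + 3 : ℂ) = c at *
  field_simp
  norm_num

theorem bessel_beta {h : ℝ} {n : ℕ} (hp : poch (n + 2 - 2 * h) (n + 2) ≠ 0) :
    bessel.beta h n = (besselBeta h n : ℂ) := by
  have h2 : (2 : ℂ) ^ n ≠ 0 := pow_ne_zero n two_ne_zero
  rw [OQM.beta, OQM.cPhi_eq bessel_Phi, show h + bessel.δ = h + -1 from rfl, bessel_c, bessel_c]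
  have hd := poch_div_poch_add_two (b := n - 2 * (h + -1 : ℝ)) (by push_cast; ring) hp
  push_cast at hd ⊢
  rw [div_eq_iff hp] at hd
  rw [hd, besselBeta, pow_add]
  push_cast
  rw [show (n + 2 - 2 * h + n : ℂ) = 2 * n - 2 * h + 2 by ring,
    show (2 * n - 2 * h + 2 + 1 : ℂ) = 2 * n - 2 * h + 3 by ring]
  generalize poch (n + 2 - 2 * h) (n + 2) = Q at *
  generalize (2 * n - 2 * h + 2 : ℂ) = b at *
  generalize (2 * n - 2 * h + 3 : ℂ) = c at *
  field_simp
  norm_num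

theorem pseudoJacobi_beta {h : ℝ} (μ : ℝ) {n : ℕ} (hp : poch (n + 2 - 2 * h) (n + 2) ≠ 0) :
    pseudoJacobi.beta (h, μ) n = 1 := by
  rw [OQM.beta, OQM.cPhi_eq pseudoJacobi_Phi, pseudoJacobi_c, pseudoJacobi_c]
  · norm_num
  · push_cast; exact hp
  · rw [poch_step] at hp
    have := left_ne_zero_of_mul hp
    convert this using 2
    simp [pseudoJacobi]
    ring

/-! ### The relation for the four families -/

theorem mainTheorem4 :
    -- Laguerre, `m = 1`
    ((∀ x : ℝ, laguerre.PhiCheck x = ((x ^ 2 : ℝ) : ℂ)) ∧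
      laguerre.cPhi = 1 ∧
      laguerre.Phi = C laguerre.cPhi * ∏ j, (X - C (laguerre.zero j)) ∧
      (∀ (g : ℝ) (n : ℕ), (∀ j : ℕ, j < n → g + 1 / 2 + j ≠ 0) →
        laguerre.rawDet g n (OQM.base 1) ≠ 0 ∧
        laguerre.c g (n + 1) ≠ 0 ∧
        (∀ x : ℝ, laguerre.PhiCheck x * laguerre.Pcheck (g + laguerre.δ) n x =
          laguerre.beta g n * ∑ k : Fin 2, laguerre.alpha g n k * laguerre.Pcheck g (n + k) x) ∧
        (∀ j, laguerre.entry g n j ≠ 0) ∧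
        laguerre.normDet g n (OQM.base 1) ≠ 0 ∧
        (∀ k : Fin 2, laguerre.alpha g n k = (-1) ^ (1 - (k : ℕ)) *
          (laguerre.normDet g n (OQM.skip k) / laguerre.normDet g n (OQM.base 1))) ∧
        (∀ k : Fin 2, laguerre.alpha g n k = (laguerreAlpha g n k : ℂ)) ∧
        laguerre.beta g n = (laguerreBeta n : ℂ)) ∧
      (∀ (g : ℝ) (n : ℕ) (x : ℝ),
        laguerre.PhiCheck x * laguerre.Pcheck (g + laguerre.δ) n x =
          (laguerreBeta n : ℂ) *
            ∑ k : Fin 2, (laguerreAlpha g n k : ℂ) * laguerre.Pcheck g (n + k) x)) ∧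
    -- Jacobi, `m = 2`
    ((∀ x : ℝ, jacobi.PhiCheck x = (((Real.sin x * Real.cos x) ^ 2 : ℝ) : ℂ)) ∧
      jacobi.cPhi = -1 / 4 ∧
      jacobi.Phi = C jacobi.cPhi * ∏ j, (X - C (jacobi.zero j)) ∧
      (∀ (g h : ℝ) (n : ℕ),
        (∀ j : ℕ, j < n → g + 1 / 2 + j ≠ 0) → (∀ j : ℕ, j < n → h + 1 / 2 + j ≠ 0) →
        2 * n + g + h + 1 ≠ 0 → (∀ j : ℕ, j < n + 2 → n + 2 + g + h + j ≠ 0) →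
        jacobi.rawDet (g, h) n (OQM.base 2) ≠ 0 ∧
        jacobi.c (g, h) (n + 2) ≠ 0 ∧
        (∀ x : ℝ, jacobi.PhiCheck x * jacobi.Pcheck ((g, h) + jacobi.δ) n x =
          jacobi.beta (g, h) n *
            ∑ k : Fin 3, jacobi.alpha (g, h) n k * jacobi.Pcheck (g, h) (n + k) x) ∧
        (∀ j, jacobi.entry (g, h) n j ≠ 0) ∧
        jacobi.normDet (g, h) n (OQM.base 2) ≠ 0 ∧
        (∀ k : Fin 3, jacobi.alpha (g, h) n k = (-1) ^ (2 - (k : ℕ)) *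
          (jacobi.normDet (g, h) n (OQM.skip k) / jacobi.normDet (g, h) n (OQM.base 2))) ∧
        (∀ k : Fin 3, jacobi.alpha (g, h) n k = (jacobiAlpha g h n k : ℂ)) ∧
        jacobi.beta (g, h) n = (jacobiBeta g h n : ℂ)) ∧
      (∀ (g h : ℝ) (n : ℕ),
        2 * n + g + h + 1 ≠ 0 → 2 * n + g + h + 2 ≠ 0 → 2 * n + g + h + 3 ≠ 0 →
        ∀ x : ℝ, jacobi.PhiCheck x * jacobi.Pcheck ((g, h) + jacobi.δ) n x =
          (jacobiBeta g h n : ℂ) *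
            ∑ k : Fin 3, (jacobiAlpha g h n k : ℂ) * jacobi.Pcheck (g, h) (n + k) x)) ∧
    -- Bessel, `m = 2`, with a double zero
    ((∀ x : ℝ, bessel.PhiCheck x = (Real.exp (2 * x) : ℂ)) ∧
      bessel.cPhi = 1 ∧
      bessel.Phi = C bessel.cPhi * ∏ j, (X - C (bessel.zero j)) ∧
      (∀ (h : ℝ) (n : ℕ),
        2 * n - 2 * h + 1 ≠ 0 → (∀ j : ℕ, j < n + 2 → n + 2 - 2 * h + j ≠ 0) →
        bessel.rawDet h n (OQM.base 2) ≠ 0 ∧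
        bessel.c h (n + 2) ≠ 0 ∧
        (∀ x : ℝ, bessel.PhiCheck x * bessel.Pcheck (h + bessel.δ) n x =
          bessel.beta h n * ∑ k : Fin 3, bessel.alpha h n k * bessel.Pcheck h (n + k) x) ∧
        ((n : ℝ) ≠ 0 → (n : ℝ) ≠ 2 * h →
          (∀ j, bessel.entry h n j ≠ 0) ∧
          bessel.normDet h n (OQM.base 2) ≠ 0 ∧
          ∀ k : Fin 3, bessel.alpha h n k = (-1) ^ (2 - (k : ℕ)) *
            (bessel.normDet h n (OQM.skip k) / bessel.normDet h n (OQM.base 2))) ∧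
        (∀ k : Fin 3, bessel.alpha h n k = (besselAlpha h n k : ℂ)) ∧
        bessel.beta h n = (besselBeta h n : ℂ)) ∧
      (∀ (h : ℝ) (n : ℕ),
        2 * n - 2 * h + 1 ≠ 0 → 2 * n - 2 * h + 2 ≠ 0 → 2 * n - 2 * h + 3 ≠ 0 →
        ∀ x : ℝ, bessel.PhiCheck x * bessel.Pcheck (h + bessel.δ) n x =
          (besselBeta h n : ℂ) *
            ∑ k : Fin 3, (besselAlpha h n k : ℂ) * bessel.Pcheck h (n + k) x)) ∧
    -- pseudo Jacobi, `m = 2`; the first hypothesis on `h` says that the polynomials are defined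
    ((∀ x : ℝ, pseudoJacobi.PhiCheck x = ((Real.cosh x ^ 2 : ℝ) : ℂ)) ∧
      pseudoJacobi.cPhi = 1 ∧
      pseudoJacobi.Phi = C pseudoJacobi.cPhi * ∏ j, (X - C (pseudoJacobi.zero j)) ∧
      (∀ (h μ : ℝ) (n : ℕ),
        (∀ i j : ℕ, i ≤ 2 → j < n + i → 2 * h ≠ n + i + j) →
        (∀ j : ℕ, j < n → ¬ (μ = 0 ∧ h = 1 / 2 + j)) →
        pseudoJacobi.rawDet (h, μ) n (OQM.base 2) ≠ 0 ∧
        pseudoJacobi.c (h, μ) (n + 2) ≠ 0 ∧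
        (∀ x : ℝ, pseudoJacobi.PhiCheck x * pseudoJacobi.Pcheck ((h, μ) + pseudoJacobi.δ) n x =
          pseudoJacobi.beta (h, μ) n *
            ∑ k : Fin 3, pseudoJacobi.alpha (h, μ) n k *
              pseudoJacobi.Pcheck (h, μ) (n + k) x) ∧
        (∀ j, pseudoJacobi.entry (h, μ) n j ≠ 0) ∧
        pseudoJacobi.normDet (h, μ) n (OQM.base 2) ≠ 0 ∧
        (∀ k : Fin 3, pseudoJacobi.alpha (h, μ) n k = (-1) ^ (2 - (k : ℕ)) *
          (pseudoJacobi.normDet (h, μ) n (OQM.skip k) /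
            pseudoJacobi.normDet (h, μ) n (OQM.base 2))) ∧
        (h ≠ n → ∀ k : Fin 3,
          pseudoJacobi.alpha (h, μ) n k = (pseudoJacobiAlpha h μ n k : ℂ)) ∧
        pseudoJacobi.beta (h, μ) n = 1) ∧
      (∀ (h μ : ℝ) (n : ℕ),
        (∀ i j : ℕ, i ≤ 2 → j < n + i → 2 * h ≠ n + i + j) → h ≠ n →
        ∀ x : ℝ, pseudoJacobi.PhiCheck x * pseudoJacobi.Pcheck ((h, μ) + pseudoJacobi.δ) n x =
          ∑ k : Fin 3, (pseudoJacobiAlpha h μ n k : ℂ) *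
            pseudoJacobi.Pcheck (h, μ) (n + k) x)) := by
  refine ⟨⟨?_, OQM.cPhi_eq laguerre_Phi, ?_, ?_, ?_⟩, ⟨?_, OQM.cPhi_eq jacobi_Phi, ?_, ?_, ?_⟩,
    ⟨?_, OQM.cPhi_eq bessel_Phi, ?_, ?_, ?_⟩,
    ⟨?_, OQM.cPhi_eq pseudoJacobi_Phi, ?_, ?_, ?_⟩⟩
  · intro x
    simp [OQM.PhiCheck, laguerre]; norm_num
  · rw [OQM.cPhi_eq laguerre_Phi]; exact laguerre_Phi
  · intro g n hg
    have he : ∀ j, laguerre.entry g n j ≠ 0 := by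
      intro j
      have := poch_ne_zero_of_real hg
      push_cast at this
      rw [laguerre_entry]
      exact div_ne_zero this (by exact_mod_cast n.factorial_ne_zero)
    have hdet : laguerre.rawDet g n (OQM.base 1) ≠ 0 := by
      rw [OQM.rawDet_one]; exact he 0
    have hb : (laguerreBeta n : ℂ) ≠ 0 := by
      have : (n + 1 : ℂ) ≠ 0 := by exact_mod_cast n.succ_ne_zero
      rw [laguerreBeta]; push_cast; exact neg_ne_zero.mpr this
    have hα := OQM.alpha_eq_of_sum_eq_zero_one (by simp [laguerreAlpha])
      (OQM.sum_mul_entry_eq_zero (Function.injective_of_subsingleton _)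
        (by rw [OQM.cPhi_eq laguerre_Phi]; exact laguerre_Phi) hb (laguerre_relation g n)) hdet
    refine ⟨hdet, ?_, fun x => ?_, he, OQM.normDet_ne_zero he hdet, OQM.alpha_eq_normDet he, hα,
      laguerre_beta g n⟩
    · rw [laguerre_c]
      exact div_ne_zero (by simp) (by exact_mod_cast (n + 1).factorial_ne_zero)
    · simp only [hα, laguerre_beta]
      exact OQM.eval_relation (laguerre_relation g n) x
  · exact fun g n x => OQM.eval_relation (laguerre_relation g n) x
  · intro x
    have h : Real.cos (2 * x) ^ 2 = 1 - 4 * (Real.sin x * Real.cos x) ^ 2 := by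
      rw [Real.cos_sq', Real.sin_two_mul]; ring
    have h' : ((Real.cos (2 * x) : ℝ) : ℂ) ^ 2 =
        1 - 4 * ((((Real.sin x * Real.cos x) ^ 2 : ℝ)) : ℂ) := by exact_mod_cast h
    simp only [OQM.PhiCheck, jacobi, eval_sub, eval_one, eval_pow, eval_X, h']
    ring
  · rw [OQM.cPhi_eq jacobi_Phi]; exact jacobi_Phi
  · intro g h n hg hh h1 hp
    -- The remaining two denominators are the last two factors of (n+2+g+h)_{n+2}; the Bessel case
    -- is analogous.
    have h2 : 2 * n + g + h + 2 ≠ 0 := fun hz => hp n (by omega) (by linarith)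
    have h3 : 2 * n + g + h + 3 ≠ 0 := fun hz => hp (n + 1) (by omega) (by push_cast; linarith)
    have hp' := poch_ne_zero_of_real hp
    push_cast at hp'
    have he := jacobi_entry_ne_zero hg hh
    have hdet := jacobi_rawDet_ne_zero he h1
    have hr := jacobi_relation g h n h1 h2 h3
    have hb : (jacobiBeta g h n : ℂ) ≠ 0 := by
      rw [jacobiBeta, Complex.ofReal_ne_zero]
      exact neg_ne_zero.mpr (div_ne_zero (by positivity) (mul_ne_zero h2 h3))
    have hα := OQM.alpha_eq_of_sum_eq_zero_two (by simp [jacobiAlpha])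
      (OQM.sum_mul_entry_eq_zero jacobi_zero_injective
        (by rw [OQM.cPhi_eq jacobi_Phi]; exact jacobi_Phi) hb hr) hdet
    refine ⟨hdet, ?_, fun x => ?_, he, OQM.normDet_ne_zero he hdet, OQM.alpha_eq_normDet he, hα,
      jacobi_beta hp'⟩
    · rw [jacobi_c]
      refine div_ne_zero ?_ (mul_ne_zero (pow_ne_zero _ two_ne_zero)
        (by exact_mod_cast (n + 2).factorial_ne_zero))
      push_cast
      exact hp'
    · simp only [hα, jacobi_beta hp']
      exact OQM.eval_relation hr x
  · exact fun g h n h1 h2 h3 x => OQM.eval_relation (jacobi_relation g h n h1 h2 h3) x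
  · intro x
    simp only [OQM.PhiCheck, bessel, eval_mul, eval_C, eval_pow, eval_X]
    rw [show 2 * x = x + x by ring, Real.exp_add]
    push_cast
    ring
  · rw [OQM.cPhi_eq bessel_Phi]; exact bessel_Phi
  · intro h n h1 hp
    have h2 : 2 * n - 2 * h + 2 ≠ 0 := fun hz => hp n (by omega) (by linarith)
    have h3 : 2 * n - 2 * h + 3 ≠ 0 := fun hz => hp (n + 1) (by omega) (by push_cast; linarith)
    have hp' := poch_ne_zero_of_real hp
    push_cast at hp'
    have hdet : bessel.rawDet h n (OQM.base 2) ≠ 0 := by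
      have : (2 * n - 2 * h + 1 : ℂ) ≠ 0 := by exact_mod_cast h1
      rw [bessel_rawDet]
      exact div_ne_zero this two_ne_zero
    have hα := OQM.alpha_eq_of_sum_eq_zero_two (by simp [besselAlpha])
      (bessel_sum_mul_entry h n h1) hdet
    refine ⟨hdet, ?_, fun x => ?_, fun hn hnh => ?_, hα, bessel_beta hp'⟩
    · rw [bessel_c]
      refine div_ne_zero ?_ (pow_ne_zero _ two_ne_zero)
      push_cast
      exact hp'
    · simp only [hα, bessel_beta hp']
      exact OQM.eval_relation (bessel_relation h n h1 h2 h3) x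
    -- The row of derivatives may be divided by n(n-2h)/2 only under these two extra conditions; the
    -- determinant itself is nonzero without them.
    · have he : ∀ j, bessel.entry h n j ≠ 0 := by
        intro j
        fin_cases j
        · simp [bessel_entry_zero]
        · have hn' : (n : ℂ) ≠ 0 := by exact_mod_cast hn
          have hd : (n - 2 * h : ℂ) ≠ 0 := sub_ne_zero.mpr (by exact_mod_cast hnh)
          simp only [Fin.mk_one, bessel_entry_one]
          exact div_ne_zero (mul_ne_zero hn' hd) two_ne_zero
      exact ⟨he, OQM.normDet_ne_zero he hdet, OQM.alpha_eq_normDet he⟩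
  · exact fun h n h1 h2 h3 x => OQM.eval_relation (bessel_relation h n h1 h2 h3) x
  · intro x
    simp only [OQM.PhiCheck, pseudoJacobi, eval_mul, eval_C, eval_add, eval_one, eval_pow, eval_X,
      Real.cosh_sq]
    push_cast
    ring
  · rw [OQM.cPhi_eq pseudoJacobi_Phi]; exact pseudoJacobi_Phi
  · intro h μ n hh hμ
    obtain ⟨h0, h1, h2, h3⟩ := pseudoJacobi_defined hh
    have hr := pseudoJacobi_relation μ h0 h1 h2 h3
    have he := pseudoJacobi_entry_ne_zero h0 hμ
    have hdet := pseudoJacobi_rawDet_ne_zero h0 h1 h3 he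
    have hα := OQM.alpha_eq_of_sum_eq_zero_two (by simp [pseudoJacobiCoeff])
      (OQM.sum_mul_entry_eq_zero pseudoJacobi_zero_injective
        (by rw [OQM.cPhi_eq pseudoJacobi_Phi]; exact pseudoJacobi_Phi) one_ne_zero hr) hdet
    refine ⟨hdet, ?_, fun x => ?_, he, OQM.normDet_ne_zero he hdet, OQM.alpha_eq_normDet he,
      fun hn k => (hα k).trans (pseudoJacobiCoeff_eq μ h2 h3 hn k), pseudoJacobi_beta μ h2⟩
    · rw [pseudoJacobi_c]
      · exact one_ne_zero
      · push_cast; exact h2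
    · simp only [hα, pseudoJacobi_beta μ h2]
      exact OQM.eval_relation hr x
  · intro h μ n hh hn x
    obtain ⟨h0, h1, h2, h3⟩ := pseudoJacobi_defined hh
    simpa only [pseudoJacobiCoeff_eq μ h2 h3 hn, one_mul] using
      OQM.eval_relation (pseudoJacobi_relation μ h0 h1 h2 h3) x
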